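/- Let $\mathcal C$ be a braided fusion category over $\mathbb C$ (for instance a modular tensor category) and let $A\in\mathcal C$ be a strongly separable commutative Frobenius algebra, i.e. a commutative algebra $(A,\mu,\iota)$ and coalgebra $(A,\Delta,\epsilon)$ satisfying the Frobenius relations and such that $\mu\circ\Delta$ and $\epsilon\circ\iota$ are nonzero multiples of identities. Let $\mathrm{Rep}A$ be the category of left $A$-modules in $\mathcal C$, with the tensor product $\otimes_A$ and unit $(A,\mu)$, and let $G=\mathrm{Aut}(A)$ be the group of algebra automorphisms of $A$ (with $gh=g\circ h$). For $g\in G$ let $T_g:\mathrm{Rep}A\to\mathrm{Rep}A$ be the functor $T_g(V,\rho_V)=(V,\rho_V\circ(g^{-1}\otimes\mathrm{id}_V))$, $T_g(f)=f$. A set $L$ of modules is called a system of representatives if it contains exactly one module from each isomorphism class of simple $A$-modules and if any two modules in $L$ whose underlying objects are isomorphic in $\mathcal C$ have the same underlying object. Such systems exist. The $T_g$, with the tensor structures $T_g(V)\otimes_A T_g(W)\cong T_g(V\otimes_A W)$ that are compatible with the projections from $V\otimes W$, the unit isomorphisms $g^{-1}:(A,\mu)\to T_g(A,\mu)$, and the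 identities $T_{gh}=T_gT_h$, $T_1=\mathrm{id}$, form an action of $G$ on $\mathrm{Rep}A$ by tensor functors. Let $L$ be any system of representatives. (1) For every $(V,\rho_V)\in L$ and $g\in G$ there is exactly one $\rho'_V$ with $(V,\rho'_V)\in L$ for which there exists an isomorphism $u_g:V\to V$ of $\mathcal C$ with $$u_g\circ\rho_V\circ(g^{-1}\otimes\mathrm{id}_V)=\rho'_V\circ(\mathrm{id}_A\otimes u_g),$$ and this $u_g$ is unique up to a nonzero scalar. Write $g\cdot(V,\rho_V)=(V,\rho'_V)$. (2) Choose such isomorphisms $u_g=u_g^V$ for all $V\in L$ and $g\in G$. Then $V\mapsto g\cdot V$ is an action of $G$ on $L$, and there are nonzero complex numbers $\beta_V(g,h)$ with $$u_g^{h\cdot V}\circ u_h^{V}=\beta_V(g,h)\,u_{gh}^{V}.$$ They form a 2-cocycle of $G$ with values in the functions on $L$: $$\beta_{h\cdot V}(f,g)\,\beta_V(fg,h)=\beta_V(f,gh)\,\beta_V(g,h)\qquad(f,g,h\in G,\ V\in L);$$ in particular $\beta_V$ is an ordinary 2-cocycle on the stabilizer of $V$. (3) There are natural isomorphisms $\gamma_{g,h}:T_{gh}\to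 T_g\circ T_h$ and $\iota:T_1\to\mathrm{id}$ satisfying the associativity and unit axioms of a $G$-action on the category $\mathrm{Rep}A$, with $\gamma_{g,h}(V)=\beta_V(g,h)^{-1}\mathrm{id}_V$ and $\iota_V=u_1^V$ for $V\in L$. For this action the module isomorphisms $u_g^V:T_gV\to g\cdot V$ $(V\in L)$ are an equivariant structure: $u_g^{h\cdot V}\circ T_g(u_h^V)\circ\gamma_{g,h}(V)=u_{gh}^V$, and for every $G$-stable $S\subseteq L$ the direct sum $X=\bigoplus_{V\in S}V$ with the isomorphisms $T_gX\to X$ whose restriction to $T_gV$ is $u^V_g:T_gV\to g\cdot V\subseteq X$ is a $G$-equivariant object. (4) There are an action $T'$ of $G$ on $\mathrm{Rep}A$ by tensor functors, with all structure isomorphisms monoidal, and monoidal natural isomorphisms $T_g\to T'_g$ compatible with the structure isomorphisms of the two actions, such that for $V\in L$ one has $T'_g(V)=g\cdot V$, the component $T_gV\to T'_gV$ is $u_g^V$, and the structure isomorphism $T'_{gh}(V)\to T'_gT'_h(V)$ is $\beta_V(g,h)\,\mathrm{id}_V$. -/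

import Mathlib

open CategoryTheory MonoidalCategory Limits MonObj

noncomputable section

namespace AnyonCondensation

universe v u w

section TensorProduct
variable {C : Type u} [Category.{v} C] [MonoidalCategory C]

instance tensorLeftPreserves [RigidCategory C] (X : C) :
    PreservesColimitsOfSize.{0, 0} (tensorLeft X) :=
  (tensorLeftAdjunction (ᘁX) X).leftAdjoint_preservesColimits

instance tensorRightPreserves [RigidCategory C] (X : C) :
    PreservesColimitsOfSize.{0, 0} (tensorRight X) :=
  (tensorRightAdjunction X (Xᘁ)).leftAdjoint_preservesColimits

/-- The action `A ⊗ V ⟶ V` of a module, as a morphism of `C`. -/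
abbrev act {A : C} [MonObj A] (M : Mod C A) : A ⊗ M.X ⟶ M.X := ModObj.smul (M := A) (X := M.X)

variable [BraidedCategory C] (A : C) [MonObj A] [IsCommMonObj A]

/-- A left module over a commutative algebra, regarded as a bimodule whose right action is
`V ⊗ A ⟶ A ⊗ V ⟶ V`, the braiding followed by the left action. -/
@[simps]
def bimod (M : Mod C A) : Bimod (Mon.mk A) (Mon.mk A) where
  X := M.X
  actLeft := act M
  one_actLeft := ModObj.one_smul_self A M.X
  left_assoc := ModObj.mul_smul_self A M.X
  actRight := (β_ M.X A).hom ≫ act M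
  actRight_one := by
    have := ModObj.one_smul_self A M.X
    simp [this]
  right_assoc := by
    have h := ModObj.mul_smul_self A M.X
    have c : (β_ A A).hom ≫ μ[A] = μ := IsCommMonObj.mul_comm A
    change M.X ◁ μ[A] ≫ (β_ M.X A).hom ≫ act M =
      (α_ M.X A A).inv ≫ ((β_ M.X A).hom ≫ act M) ▷ A ≫ (β_ M.X A).hom ≫ act M
    rw [BraidedCategory.braiding_naturality_right_assoc, h, comp_whiskerRight,
      Category.assoc, BraidedCategory.braiding_naturality_left_assoc,
      BraidedCategory.braiding_tensor_right_hom, BraidedCategory.braiding_tensor_left_hom]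
    simp only [Category.assoc, Iso.inv_hom_id_assoc]
    rw [← h, ← comp_whiskerRight_assoc, c, h, Iso.inv_hom_id_assoc]
  middle_assoc := by
    have h := ModObj.mul_smul_self A M.X
    have c : (β_ A A).hom ≫ μ[A] = μ := IsCommMonObj.mul_comm A
    change act M ▷ A ≫ (β_ M.X A).hom ≫ act M =
      (α_ A M.X A).hom ≫ A ◁ ((β_ M.X A).hom ≫ act M) ≫ act M
    rw [BraidedCategory.braiding_naturality_left_assoc,
      BraidedCategory.braiding_tensor_left_hom]
    simp only [Category.assoc, whiskerLeft_comp]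
    rw [← h, ← comp_whiskerRight_assoc, c, h, Iso.inv_hom_id_assoc]

def modOfBimod (P : Bimod (Mon.mk A) (Mon.mk A)) : Mod C A :=
  letI : ModObj A P.X :=
    { smul := P.actLeft
      one_smul := P.one_actLeft
      mul_smul := P.left_assoc }
  ⟨P.X⟩

def bimodFunctor : Mod C A ⥤ Bimod (Mon.mk A) (Mon.mk A) where
  obj M := bimod A M
  map f :=
    { hom := f.hom
      left_act_hom := f.isModHom.smul_hom
      right_act_hom := by
        have h : act _ ≫ f.hom = A ◁ f.hom ≫ act _ := f.isModHom.smul_hom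
        change ((β_ _ A).hom ≫ act _) ≫ f.hom = f.hom ▷ A ≫ (β_ _ A).hom ≫ act _
        rw [Category.assoc, h, BraidedCategory.braiding_naturality_left_assoc] }

def modFunctor : Bimod (Mon.mk A) (Mon.mk A) ⥤ Mod C A where
  obj P := modOfBimod A P
  map {P Q} f := Mod.Hom.mk' (M := modOfBimod A P) (N := modOfBimod A Q) f.hom f.left_act_hom

instance : (bimodFunctor A).Faithful where
  map_injective h := by
    apply Mod.hom_ext
    exact congrArg Bimod.Hom.hom h

variable [HasCoequalizers C] [RigidCategory C]

instance bimodMonoidal : MonoidalCategory (Bimod (Mon.mk A) (Mon.mk A)) :=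
  letI : Bicategory (Mon C) := Bimod.monBicategory
  inferInstanceAs (MonoidalCategory (EndMonoidal (Mon.mk A)))

/-- The tensor product `V ⊗_A W` of modules: the coequalizer of the right action on `V` and the left
action on `W`. -/
def tensorMod (M N : Mod C A) : Mod C A := modOfBimod A ((bimod A M).tensorBimod (bimod A N))

/-- The canonical projection `V ⊗ W ⟶ V ⊗_A W`. -/
def tensorMod.π (M N : Mod C A) : M.X ⊗ N.X ⟶ (tensorMod A M N).X :=
  coequalizer.π _ _

instance (M N : Mod C A) : Epi (tensorMod.π A M N) := by
  unfold tensorMod.π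
  exact coequalizer.π_epi


lemma tensorMod.π_smul (M N : Mod C A) :
    A ◁ tensorMod.π A M N ≫ act (tensorMod A M N) =
      (α_ _ _ _).inv ≫ act M ▷ N.X ≫ tensorMod.π A M N :=
  Bimod.TensorBimod.whiskerLeft_π_actLeft (bimod A M) (bimod A N)

lemma tensorMod.condition (M N : Mod C A) :
    ((β_ M.X A).hom ≫ act M) ▷ N.X ≫ tensorMod.π A M N =
      (α_ _ _ _).hom ≫ M.X ◁ act N ≫ tensorMod.π A M N :=
  (coequalizer.condition ((bimod A M).actRight ▷ (bimod A N).X)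
    ((α_ _ _ _).hom ≫ ((bimod A M).X ◁ (bimod A N).actLeft))).trans (Category.assoc _ _ _)

lemma tensor_actRight (M N : Mod C A) :
    ((bimod A M).tensorBimod (bimod A N)).actRight = (bimod A (tensorMod A M N)).actRight := by
  have e : Epi (tensorMod.π A M N ▷ A) :=
    inferInstanceAs (Epi ((tensorRight A).map (tensorMod.π A M N)))
  refine (cancel_epi (tensorMod.π A M N ▷ A)).1 ?_
  refine (Bimod.TensorBimod.π_tensor_id_actRight (bimod A M) (bimod A N)).trans ?_
  change (α_ M.X N.X A).hom ≫ M.X ◁ ((β_ N.X A).hom ≫ act N) ≫ tensorMod.π A M N =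
    tensorMod.π A M N ▷ A ≫ (β_ (tensorMod A M N).X A).hom ≫ act (tensorMod A M N)
  rw [BraidedCategory.braiding_naturality_left_assoc, tensorMod.π_smul,
    BraidedCategory.braiding_tensor_left_hom]
  have c := tensorMod.condition A M N
  simp only [comp_whiskerRight, Category.assoc] at c
  simp only [Category.assoc, whiskerLeft_comp, Iso.hom_inv_id_assoc]
  rw [c, Iso.inv_hom_id_assoc]

/-- `V ⊗_A W` carries the right action of the bimodule tensor product. -/
def bimodTensorIso (M N : Mod C A) :
    (bimod A M).tensorBimod (bimod A N) ≅ bimod A (tensorMod A M N) :=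
  Bimod.isoOfIso (Iso.refl (tensorMod A M N).X)
    (by
      refine (Category.comp_id _).trans ?_
      refine Eq.trans ?_ (congrArg (· ≫ act (tensorMod A M N)) (whiskerLeft_id A _).symm)
      exact (Category.id_comp (act (tensorMod A M N))).symm)
    (by
      refine (Category.comp_id _).trans ((tensor_actRight A M N).trans ?_)
      refine Eq.trans ?_ (congrArg (· ≫ (bimod A (tensorMod A M N)).actRight)
        (id_whiskerRight _ A).symm)
      exact (Category.id_comp (bimod A (tensorMod A M N)).actRight).symm)

/-- The regular bimodule is the regular module. -/
def bimodUnitIso : Bimod.regular (Mon.mk A) ≅ bimod A (Mod.regular A) :=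
  Bimod.isoOfIso (Iso.refl A)
    (by
      change μ[A] ≫ 𝟙 A = A ◁ 𝟙 A ≫ μ[A]
      simp)
    (by
      change μ[A] ≫ 𝟙 A = 𝟙 A ▷ A ≫ (β_ A A).hom ≫ μ[A]
      simp)

instance modMonoidalStruct : MonoidalCategoryStruct (Mod C A) where
  tensorObj M N := tensorMod A M N
  tensorUnit := Mod.regular A
  whiskerLeft M _ _ f := (modFunctor A).map (Bimod.whiskerLeft (bimod A M) ((bimodFunctor A).map f))
  whiskerRight f N := (modFunctor A).map (Bimod.whiskerRight ((bimodFunctor A).map f) (bimod A N))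
  associator M N P := (modFunctor A).mapIso
    (whiskerRightIso (bimodTensorIso A M N).symm (bimod A P) ≪≫
      Bimod.associatorBimod (bimod A M) (bimod A N) (bimod A P) ≪≫
      whiskerLeftIso (bimod A M) (bimodTensorIso A N P))
  leftUnitor M := (modFunctor A).mapIso
    (whiskerRightIso (bimodUnitIso A).symm (bimod A M) ≪≫ Bimod.leftUnitorBimod (bimod A M))
  rightUnitor M := (modFunctor A).mapIso
    (whiskerLeftIso (bimod A M) (bimodUnitIso A).symm ≪≫ Bimod.rightUnitorBimod (bimod A M))


instance modMonoidal : MonoidalCategory (Mod C A) :=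
  Monoidal.induced (bimodFunctor A)
    { μIso := fun M N => bimodTensorIso A M N
      εIso := bimodUnitIso A
      whiskerLeft_eq := fun M _ _ f => Bimod.hom_ext _ _
        ((Category.id_comp _).trans (Category.comp_id _)).symm
      whiskerRight_eq := fun f N => Bimod.hom_ext _ _
        ((Category.id_comp _).trans (Category.comp_id _)).symm
      tensorHom_eq := fun {X₁ Y₁ X₂ Y₂} f g => by
        rw [MonoidalCategory.tensorHom_def]
        apply Bimod.hom_ext
        exact ((Category.id_comp _).trans (Category.comp_id _)).symm
      associator_eq := fun M N P => by
        simp only [Iso.trans_hom, tensorIso_hom, Iso.refl_hom, tensorHom_id, Category.assoc]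
        apply Bimod.hom_ext
        refine Eq.trans ?_ (Category.id_comp _).symm
        have e := congrArg Bimod.Hom.hom
          (id_tensorHom (bimod A M) (bimodTensorIso A N P).hom)
        refine congrArg (fun t => Bimod.Hom.hom ((bimodTensorIso A M N).inv ▷ bimod A P) ≫
          (Bimod.associatorBimod (bimod A M) (bimod A N) (bimod A P)).hom.hom ≫ t) ?_
        exact (e.symm.trans (Category.comp_id _).symm)
      leftUnitor_eq := fun M => by
        simp only [Iso.trans_hom, tensorIso_hom, Iso.refl_hom, tensorHom_id,
          Category.assoc]
        apply Bimod.hom_ext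
        exact (Category.id_comp _).symm
      rightUnitor_eq := fun M => by
        simp only [Iso.trans_hom, tensorIso_hom, Iso.refl_hom, id_tensorHom,
          Category.assoc]
        apply Bimod.hom_ext
        exact (Category.id_comp _).symm }

end TensorProduct


/-! ### The ambient category and the algebra -/

section Ambient
variable (C : Type u) [Category.{v} C] [Abelian C] [Linear ℂ C] [MonoidalCategory C]

/-- The finiteness and semisimplicity axioms of a fusion category over `ℂ` (to be used together with
`MonoidalPreadditive C`, `MonoidalLinear ℂ C` and `RigidCategory C`). -/
class IsFusion : Prop where
  finite_hom : ∀ X Y : C, FiniteDimensional ℂ (X ⟶ Y)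
  semisimple : ∀ X : C, ∃ (n : ℕ) (S : Fin n → C), (∀ i, Simple (S i)) ∧ Nonempty (X ≅ ∐ S)
  finite_simple : ∃ (n : ℕ) (S : Fin n → C), ∀ X : C, Simple X → ∃ i, Nonempty (X ≅ S i)
  simple_unit : Simple (𝟙_ C)

variable {C}

/-- A strongly separable Frobenius algebra: an algebra and coalgebra satisfying the Frobenius
relations, for which `μ ∘ Δ` and `ε ∘ η` are nonzero multiples of identities. -/
structure IsStronglySeparableFrobenius (A : C) [MonObj A] [ComonObj A] : Prop where
  frobenius_left : A ◁ ComonObj.comul ≫ (α_ A A A).inv ≫ MonObj.mul ▷ A =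
    (MonObj.mul ≫ ComonObj.comul : A ⊗ A ⟶ A ⊗ A)
  frobenius_right : ComonObj.comul ▷ A ≫ (α_ A A A).hom ≫ A ◁ MonObj.mul =
    (MonObj.mul ≫ ComonObj.comul : A ⊗ A ⟶ A ⊗ A)
  mul_comul : ∃ c : ℂ, c ≠ 0 ∧ (ComonObj.comul ≫ MonObj.mul : A ⟶ A) = c • 𝟙 A
  counit_unit : ∃ c : ℂ, c ≠ 0 ∧ ((MonObj.one : 𝟙_ C ⟶ A) ≫ ComonObj.counit : 𝟙_ C ⟶ 𝟙_ C) = c • 𝟙 (𝟙_ C)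

end Ambient

/-! ### The linear structure of the category of modules -/

section LinearStructure
variable {C : Type u} [Category.{v} C] [MonoidalCategory C] {A : C} [MonObj A]

lemma act_hom {M N : Mod C A} (f : M ⟶ N) : act M ≫ f.hom = A ◁ f.hom ≫ act N :=
  f.isModHom.smul_hom

/-- A morphism of `C` commuting with the actions, as a morphism of modules. -/
def mkHom {M N : Mod C A} (f : M.X ⟶ N.X) (h : act M ≫ f = A ◁ f ≫ act N) : M ⟶ N :=
  Mod.Hom.mk' f h

@[simp] lemma mkHom_hom {M N : Mod C A} (f : M.X ⟶ N.X) (h : act M ≫ f = A ◁ f ≫ act N) :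
    (mkHom f h).hom = f := rfl

variable [Preadditive C] [MonoidalPreadditive C]

instance (M N : Mod C A) : Zero (M ⟶ N) := ⟨mkHom 0 (by simp)⟩

instance (M N : Mod C A) : Add (M ⟶ N) where
  add f g := mkHom (f.hom + g.hom) (by
    rw [MonoidalPreadditive.whiskerLeft_add, Preadditive.comp_add, Preadditive.add_comp, act_hom,
      act_hom])

instance (M N : Mod C A) : Neg (M ⟶ N) where
  neg f := mkHom (-f.hom) (by
    have e : A ◁ (-f.hom) = -(A ◁ f.hom) := ((tensoringLeft C).obj A).map_neg
    rw [e, Preadditive.comp_neg, Preadditive.neg_comp, act_hom])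

instance (M N : Mod C A) : AddCommGroup (M ⟶ N) where
  nsmul := nsmulRec
  zsmul := zsmulRec
  add_assoc _ _ _ := Mod.hom_ext _ _ (add_assoc _ _ _)
  zero_add _ := Mod.hom_ext _ _ (zero_add _)
  add_zero _ := Mod.hom_ext _ _ (add_zero _)
  neg_add_cancel _ := Mod.hom_ext _ _ (neg_add_cancel _)
  add_comm _ _ := Mod.hom_ext _ _ (add_comm _ _)

@[simp] lemma zero_hom (M N : Mod C A) : (0 : M ⟶ N).hom = 0 := rfl
@[simp] lemma add_hom {M N : Mod C A} (f g : M ⟶ N) : (f + g).hom = f.hom + g.hom := rfl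
@[simp] lemma neg_hom {M N : Mod C A} (f : M ⟶ N) : (-f).hom = -f.hom := rfl

instance : Preadditive (Mod C A) where
  add_comp _ _ _ _ _ _ := Mod.hom_ext _ _ (Preadditive.add_comp _ _ _ _ _ _)
  comp_add _ _ _ _ _ _ := Mod.hom_ext _ _ (Preadditive.comp_add _ _ _ _ _ _)

variable [Linear ℂ C] [MonoidalLinear ℂ C]

instance (M N : Mod C A) : Module ℂ (M ⟶ N) where
  smul c f := mkHom (c • f.hom) (by
    rw [MonoidalLinear.whiskerLeft_smul, Linear.comp_smul, Linear.smul_comp, act_hom])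
  one_smul _ := Mod.hom_ext _ _ (one_smul _ _)
  mul_smul _ _ _ := Mod.hom_ext _ _ (mul_smul _ _ _)
  smul_zero _ := Mod.hom_ext _ _ (smul_zero _)
  smul_add _ _ _ := Mod.hom_ext _ _ (smul_add _ _ _)
  add_smul _ _ _ := Mod.hom_ext _ _ (add_smul _ _ _)
  zero_smul _ := Mod.hom_ext _ _ (zero_smul _ _)

@[simp] lemma smul_hom {M N : Mod C A} (c : ℂ) (f : M ⟶ N) : (c • f).hom = c • f.hom := rfl

instance : Linear ℂ (Mod C A) where
  smul_comp _ _ _ _ _ _ := Mod.hom_ext _ _ (Linear.smul_comp _ _ _ _ _ _)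
  comp_smul _ _ _ _ _ _ := Mod.hom_ext _ _ (Linear.comp_smul _ _ _ _ _ _)

end LinearStructure

/-! ### Group actions on categories -/

section GroupAction
variable {G : Type w} [Group G] {D : Type u} [Category.{v} D]

/-- A coherent action of the group `G` on the category `D` by the functors `T g`: isomorphisms
`mulIso g h : T (g h) ≅ T g ∘ T h` and `oneIso : T 1 ≅ id`, associative and unital. -/
structure GroupAction (T : G → D ⥤ D) where
  mulIso (g h : G) : T (g * h) ≅ T h ⋙ T g
  oneIso : T 1 ≅ 𝟭 D
  assoc (f g h : G) (X : D) :
    (mulIso (f * g) h).hom.app X ≫ (mulIso f g).hom.app ((T h).obj X) =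
      eqToHom (by rw [_root_.mul_assoc]) ≫ (mulIso f (g * h)).hom.app X ≫ (T f).map ((mulIso g h).hom.app X)
  unit_left (g : G) (X : D) :
    (mulIso 1 g).hom.app X ≫ oneIso.hom.app ((T g).obj X) = eqToHom (by rw [_root_.one_mul]; rfl)
  unit_right (g : G) (X : D) :
    (mulIso g 1).hom.app X ≫ (T g).map (oneIso.hom.app X) = eqToHom (by rw [_root_.mul_one]; rfl)

/-- A coherent action of `G` on the monoidal category `D` by monoidal functors `T g`, all of whose
structure isomorphisms `mulIso`, `oneIso` are monoidal natural transformations. -/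
structure TensorGroupAction [MonoidalCategory D] (T : G → D ⥤ D) extends GroupAction T where
  monoidal (g : G) : (T g).Monoidal
  mulIso_monoidal (g h : G) : NatTrans.IsMonoidal (mulIso g h).hom
  oneIso_monoidal : NatTrans.IsMonoidal oneIso.hom

/-- An equivariant object for a group action: an object `obj` with isomorphisms
`u g : T g obj ≅ obj` such that `u g ∘ T g (u h) ∘ mulIso g h = u (g h)`. -/
structure EquivariantObject {T : G → D ⥤ D} (b : GroupAction T) where
  obj : D
  u (g : G) : (T g).obj obj ≅ obj
  square (g h : G) :
    (b.mulIso g h).hom.app obj ≫ (T g).map (u h).hom ≫ (u g).hom = (u (g * h)).hom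

end GroupAction

/-! ### The twisted modules and the intertwiners -/

section Twist
variable {C : Type u} [Category.{v} C] [MonoidalCategory C] (A : C) [MonObj A]

/-- The group of algebra automorphisms of `A`; the product is composition, `g * h = g ∘ h`. -/
abbrev AutAlg := Aut (Mon.mk A)

variable {A}

/-- The functor `T_g (V, ρ) = (V, ρ ∘ (g⁻¹ ⊗ id))`, `T_g f = f`. -/
abbrev twist (g : AutAlg A) : Mod C A ⥤ Mod C A :=
  letI : IsMonHom (M := A) (N := A) (g⁻¹).hom.hom := (g⁻¹).hom.isMonHom_hom
  Mod.comap (A := A) (B := A) (g⁻¹).hom.hom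

/-- `u ∘ ρ_V ∘ (g⁻¹ ⊗ id) = ρ_W ∘ (id ⊗ u)`. -/
def Intertwines (g : AutAlg A) (V W : Mod C A) (u : V.X ⟶ W.X) : Prop :=
  (g⁻¹).hom.hom ▷ V.X ≫ act V ≫ u = A ◁ u ≫ act W

/-- An intertwiner is the same as a module morphism `T_g V ⟶ W`. -/
def Intertwines.toHom {g : AutAlg A} {V W : Mod C A} {u : V.X ⟶ W.X} (h : Intertwines g V W u) :
    (twist g).obj V ⟶ W :=
  mkHom (M := (twist g).obj V) u ((Category.assoc _ _ _).trans h)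

/-- The module `(V, ρ')` with the same underlying object as `V`. -/
abbrev withAct (V : Mod C A) (ρ' : ModObj A V.X) : Mod C A := @CategoryTheory.Mod.mk C _ _ C _ _ A _ V.X ρ'

end Twist

/-! ### Representatives of the simple modules -/

section Representatives
variable {C : Type u} [Category.{v} C] [Preadditive C] [MonoidalCategory C] [MonoidalPreadditive C]
  {A : C} [MonObj A]

/-- `L` contains exactly one module from each isomorphism class of simple modules, and the modules
in `L` whose underlying objects are isomorphic have the same underlying object. -/
structure IsRepresentatives (L : Set (Mod C A)) : Prop where
  simple : ∀ V ∈ L, Simple V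
  exists_iso : ∀ V : Mod C A, Simple V → ∃ W ∈ L, Nonempty (V ≅ W)
  eq_of_iso : ∀ V ∈ L, ∀ W ∈ L, Nonempty (V ≅ W) → V = W
  eq_underlying : ∀ V ∈ L, ∀ W ∈ L, Nonempty (V.X ≅ W.X) → V.X = W.X

/-- A choice, for all `(V, ρ) ∈ L` and all `g`, of a representative `(V, ρ') ∈ L` and an isomorphism
`u_g : V ≅ V` of `C` intertwining the `g`-twisted action `ρ ∘ (g⁻¹ ⊗ id)` with `ρ'`. -/
structure Intertwiners (L : Set (Mod C A)) where
  rho (g : AutAlg A) (V : L) : ModObj A V.1.X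
  mem (g : AutAlg A) (V : L) : withAct V.1 (rho g V) ∈ L
  u (g : AutAlg A) (V : L) : V.1.X ≅ V.1.X
  intertwines (g : AutAlg A) (V : L) : Intertwines g V.1 (withAct V.1 (rho g V)) (u g V).hom

namespace Intertwiners
variable {L : Set (Mod C A)} (D : Intertwiners L)

/-- The representative `g • (V, ρ) = (V, ρ')` of `T_g (V, ρ)`. -/
abbrev rep (g : AutAlg A) (V : L) : L := ⟨withAct V.1 (D.rho g V), D.mem g V⟩

/-- `u_g` as a morphism of modules `T_g V ⟶ g • V`. -/
abbrev hom (g : AutAlg A) (V : L) : (twist g).obj V.1 ⟶ (D.rep g V).1 := (D.intertwines g V).toHom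

end Intertwiners

end Representatives

end AnyonCondensation

end

open CategoryTheory MonoidalCategory Limits MonObj

noncomputable section

namespace AnyonCondensation

universe v u w

/-! ### Twisting by automorphisms: the strict action on modules -/

section Basic
variable {C : Type u} [Category.{v} C] [MonoidalCategory C] {A : C} [MonObj A]

/-! Twisting changes the action on a module but neither its underlying object nor any underlying
morphism. Hence `T_{gh}` and `T_g T_h` differ only by identities of `C`, and coherence of the strict
action is checked on underlying morphisms. The tensor structure is forced by the projections `V ⊗ W
⟶ V ⊗_A W`: by naturality of the braiding, being balanced for `V, W` and for `T_g V, T_g W` are the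
same condition up to precomposition with `g⁻¹` on the middle factor `A`. All tensor identities
follow by cancelling projections, which are epi and remain epi after tensoring because `C` is rigid.

Schur's lemma produces `β`. The module `T_g V` is simple, hence isomorphic to exactly one member of
`L`, which has the same underlying object as `V`; the isomorphism `u_g` is unique up to a scalar
(`Intertwines.exists_smul`). Both `u_g u_h` and `u_{gh}` are isomorphisms from `T_{gh} V` to
`(gh)·V`, so they are proportional, and the two bracketings of `u_f u_g u_h` give the cocycle
identity.

For the action with constraint `β⁻¹`, a scalar given only on `L` must be extended naturally to all
modules. This needs semisimplicity (`isSemisimple`), proved as in Maschke's theorem: `Δ(1)` is a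
separability element, and averaging over it makes retractions in `C` module morphisms. Every
function `L → ℂˣ` is then realised by a unique natural automorphism of the identity functor
(`natScalar`, `IsRepresentatives.natural_ext`). At `T_h M` it equals the automorphism at `M` of the
function translated by `h` (`natScalarHom_twist`), so the coherence axioms become the cocycle
identity and the values of `β` at `1`. Finiteness of `L`, needed for direct sums, holds because each
simple module is a constituent of one of finitely many free modules.

The last claim is transport of structure: each `T_g` is replaced by an isomorphic functor with value
`g·V` on `L`, with `u_g` as comparison there. No scalar is inserted; `β` appears because it measures
the failure of the comparisons to compose strictly. -/

lemma eqToHom_hom {M N : Mod C A} (h : M = N) :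
    (eqToHom h).hom = eqToHom (congrArg Mod.X h) := by
  subst h; rfl

/-- A module morphism whose underlying morphism is invertible, as an isomorphism of modules. -/
@[simps]
def mkIso {M N : Mod C A} (f : M ⟶ N) [IsIso f.hom] : M ≅ N where
  hom := f
  inv := mkHom (inv f.hom) (by rw [IsIso.comp_inv_eq, Category.assoc, act_hom,
    ← MonoidalCategory.whiskerLeft_comp_assoc, IsIso.inv_hom_id]; simp)
  hom_inv_id := Mod.hom_ext _ _ (IsIso.hom_inv_id f.hom)
  inv_hom_id := Mod.hom_ext _ _ (IsIso.inv_hom_id f.hom)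

lemma isIso_iff_hom {M N : Mod C A} (f : M ⟶ N) : IsIso f ↔ IsIso f.hom :=
  ⟨fun _ => inferInstanceAs (IsIso ((Mod.forget A).map f)), fun _ => (mkIso f).isIso_hom⟩

/-- The underlying isomorphism of an isomorphism of modules. -/
abbrev homIso {M N : Mod C A} (e : M ≅ N) : M.X ≅ N.X := (Mod.forget A).mapIso e

instance {M N : Mod C A} (f : M ⟶ N) [IsIso f] : IsIso f.hom := (isIso_iff_hom f).1 ‹_›

lemma twist_map_hom (g : AutAlg A) {V W : Mod C A} (f : V ⟶ W) :
    ((twist g).map f).hom = f.hom := rfl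

lemma inv_mul_hom (g h : AutAlg A) :
    ((g * h)⁻¹).hom.hom = (g⁻¹).hom.hom ≫ (h⁻¹).hom.hom := by
  rw [mul_inv_rev]; rfl

lemma inv_one_hom : ((1 : AutAlg A)⁻¹).hom.hom = 𝟙 A := by
  rw [inv_one]; rfl

instance (g : AutAlg A) : IsIso g.hom.hom :=
  ⟨g.inv.hom, congrArg Mon.Hom.hom g.hom_inv_id, congrArg Mon.Hom.hom g.inv_hom_id⟩

/-- The composition law `T_{gh} = T_g T_h` of the twist functors. -/
def twistMulIso (g h : AutAlg A) : twist (g * h) ≅ twist h ⋙ twist g :=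
  NatIso.ofComponents (fun V =>
    { hom := mkHom (𝟙 V.X) (by
        change (((g * h)⁻¹).hom.hom ▷ V.X ≫ act V) ≫ 𝟙 _ =
          A ◁ 𝟙 _ ≫ (g⁻¹).hom.hom ▷ V.X ≫ (h⁻¹).hom.hom ▷ V.X ≫ act V
        rw [inv_mul_hom]; simp)
      inv := mkHom (𝟙 V.X) (by
        change ((g⁻¹).hom.hom ▷ V.X ≫ (h⁻¹).hom.hom ▷ V.X ≫ act V) ≫ 𝟙 _ =
          A ◁ 𝟙 _ ≫ ((g * h)⁻¹).hom.hom ▷ V.X ≫ act V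
        rw [inv_mul_hom]; simp)
      hom_inv_id := Mod.hom_ext _ _ (Category.id_comp _)
      inv_hom_id := Mod.hom_ext _ _ (Category.id_comp _) })
    (fun k => Mod.hom_ext _ _ ((Category.comp_id k.hom).trans (Category.id_comp k.hom).symm))

/-- The unit law `T_1 = id` of the twist functors. -/
def twistOneIso : twist (1 : AutAlg A) ≅ 𝟭 (Mod C A) :=
  NatIso.ofComponents (fun V =>
    { hom := mkHom (𝟙 V.X) (by
        change (((1 : AutAlg A)⁻¹).hom.hom ▷ V.X ≫ act V) ≫ 𝟙 _ = A ◁ 𝟙 _ ≫ act V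
        rw [inv_one_hom]; simp)
      inv := mkHom (𝟙 V.X) (by
        change act V ≫ 𝟙 _ = A ◁ 𝟙 _ ≫ ((1 : AutAlg A)⁻¹).hom.hom ▷ V.X ≫ act V
        rw [inv_one_hom]; simp)
      hom_inv_id := Mod.hom_ext _ _ (Category.id_comp _)
      inv_hom_id := Mod.hom_ext _ _ (Category.id_comp _) })
    (fun k => Mod.hom_ext _ _ ((Category.comp_id k.hom).trans (Category.id_comp k.hom).symm))

@[simp] lemma twistMulIso_hom_app_hom (g h : AutAlg A) (V : Mod C A) :
    ((twistMulIso g h).hom.app V).hom = 𝟙 V.X := rfl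

@[simp] lemma twistOneIso_hom_app_hom (V : Mod C A) :
    ((twistOneIso (A := A)).hom.app V).hom = 𝟙 V.X := rfl

/-- The strict action of `Aut(A)` on the category of modules. -/
def twistAction : GroupAction (fun g : AutAlg A => twist g) where
  mulIso := twistMulIso
  oneIso := twistOneIso
  assoc _ _ _ X := Mod.hom_ext _ _ (by
    simp only [Mod.comp_hom', eqToHom_hom, twist_map_hom, twistMulIso_hom_app_hom]
    exact (Category.id_comp (𝟙 X.X)).trans
      ((Category.id_comp _).trans (Category.id_comp (𝟙 X.X))).symm)
  unit_left _ X := Mod.hom_ext _ _ (by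
    simp only [Mod.comp_hom', eqToHom_hom, twistMulIso_hom_app_hom, twistOneIso_hom_app_hom]
    exact Category.id_comp _)
  unit_right _ X := Mod.hom_ext _ _ (by
    simp only [Mod.comp_hom', eqToHom_hom, twist_map_hom, twistMulIso_hom_app_hom,
      twistOneIso_hom_app_hom]
    exact Category.id_comp _)

end Basic

/-! ### Kernels of module morphisms and simplicity of twists -/

section Preadditive
variable {C : Type u} [Category.{v} C] [MonoidalCategory C] {A : C} [MonObj A]
variable [Preadditive C] [MonoidalPreadditive C]

lemma sum_hom {J : Type*} (s : Finset J) {M N : Mod C A} (f : J → (M ⟶ N)) :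
    (∑ i ∈ s, f i).hom = ∑ i ∈ s, (f i).hom :=
  map_sum (AddMonoidHom.mk' (fun f : M ⟶ N => f.hom) add_hom) f s

/-- The kernel of a module morphism: the kernel in `C` with the induced action. -/
def kernelMod [HasKernels C] {M N : Mod C A} (f : M ⟶ N) : Mod C A :=
  letI : ModObj A (kernel f.hom) :=
    { smul := kernel.lift f.hom (A ◁ kernel.ι f.hom ≫ act M) (by
        rw [Category.assoc, act_hom, ← MonoidalCategory.whiskerLeft_comp_assoc, kernel.condition]
        simp)
      one_smul := by
        refine (cancel_mono (kernel.ι f.hom)).1 ?_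
        change (η[A] ▷ kernel f.hom ≫ kernel.lift f.hom _ _) ≫ _ = (λ_ _).hom ≫ _
        rw [Category.assoc, kernel.lift_ι, ← whisker_exchange_assoc, ModObj.one_smul_self,
          leftUnitor_naturality]
      mul_smul := by
        refine (cancel_mono (kernel.ι f.hom)).1 ?_
        change (μ[A] ▷ kernel f.hom ≫ kernel.lift f.hom _ _) ≫ _ =
          ((α_ _ _ _).hom ≫ A ◁ kernel.lift f.hom _ _ ≫ kernel.lift f.hom _ _) ≫ _
        simp only [Category.assoc, kernel.lift_ι]
        rw [← whisker_exchange_assoc, ModObj.mul_smul_self,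
          ← MonoidalCategory.whiskerLeft_comp_assoc, kernel.lift_ι]
        simp }
  ⟨kernel f.hom⟩

/-- The inclusion of the kernel. -/
def kernelMod.incl [HasKernels C] {M N : Mod C A} (f : M ⟶ N) : kernelMod f ⟶ M :=
  mkHom (kernel.ι f.hom) (kernel.lift_ι _ _ _)

lemma kernelMod.condition [HasKernels C] {M N : Mod C A} (f : M ⟶ N) : kernelMod.incl f ≫ f = 0 :=
  Mod.hom_ext _ _ (kernel.condition _)

instance [HasKernels C] {M N : Mod C A} (f : M ⟶ N) : Mono (kernelMod.incl f).hom :=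
  inferInstanceAs (Mono (kernel.ι f.hom))

/-- The factorization through the kernel. -/
def kernelMod.lift [HasKernels C] {M N P : Mod C A} (f : M ⟶ N) (k : P ⟶ M) (h : k ≫ f = 0) :
    P ⟶ kernelMod f :=
  mkHom (kernel.lift f.hom k.hom (congrArg Mod.Hom.hom h)) (by
    refine (cancel_mono (kernelMod.incl f).hom).1 ?_
    have h' : k.hom ≫ f.hom = 0 := congrArg Mod.Hom.hom h
    have e : act (kernelMod f) ≫ kernel.ι f.hom = A ◁ kernel.ι f.hom ≫ act M := kernel.lift_ι _ _ _
    change (act P ≫ kernel.lift f.hom k.hom h') ≫ kernel.ι f.hom =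
      (A ◁ kernel.lift f.hom k.hom h' ≫ act (kernelMod f)) ≫ kernel.ι f.hom
    refine Eq.trans ?_ (Category.assoc _ _ _).symm
    refine Eq.trans ?_ (congrArg (A ◁ kernel.lift f.hom k.hom h' ≫ ·) e.symm)
    rw [Category.assoc, kernel.lift_ι, ← MonoidalCategory.whiskerLeft_comp_assoc, kernel.lift_ι,
      act_hom])

lemma kernelMod.lift_incl [HasKernels C] {M N P : Mod C A} (f : M ⟶ N) (k : P ⟶ M)
    (h : k ≫ f = 0) : kernelMod.lift f k h ≫ kernelMod.incl f = k :=
  Mod.hom_ext _ _ (kernel.lift_ι _ _ _)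

instance {M N : Mod C A} (f : M ⟶ N) [Mono f.hom] : Mono f :=
  ⟨fun _ _ e => Mod.hom_ext _ _ ((cancel_mono f.hom).1 (congrArg Mod.Hom.hom e))⟩

instance [HasKernels C] : HasKernels (Mod C A) where
  has_limit f := HasLimit.mk ⟨KernelFork.ofι (kernelMod.incl f) (kernelMod.condition f),
    KernelFork.IsLimit.ofι' _ _ (fun k h => ⟨kernelMod.lift f k h, kernelMod.lift_incl f k h⟩)⟩

/-- The kernel in `C` carries a module structure, so a module morphism that is mono among modules
already has zero kernel in `C`. This gives access to injectivity and splittings in `C`. -/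
lemma mono_hom [HasKernels C] {M N : Mod C A} (f : M ⟶ N) [Mono f] : Mono f.hom := by
  have h : kernelMod.incl f = 0 := (cancel_mono f).1 (by rw [kernelMod.condition, zero_comp])
  exact Preadditive.mono_of_kernel_zero (congrArg Mod.Hom.hom h)

/-- The transpose of a morphism `Y ⟶ T_g V`. -/
def ofTwist {g : AutAlg A} {Y V : Mod C A} (f : Y ⟶ (twist g).obj V) :
    (twist g⁻¹).obj Y ⟶ V :=
  mkHom (M := (twist g⁻¹).obj Y) f.hom (by
    have key (σ τ : A ⟶ A) (e : σ ≫ τ = 𝟙 A) (k : Y.X ⟶ V.X)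
        (h : act Y ≫ k = A ◁ k ≫ τ ▷ V.X ≫ act V) :
        (σ ▷ Y.X ≫ act Y) ≫ k = A ◁ k ≫ act V := by
      rw [Category.assoc, h, ← whisker_exchange_assoc, ← comp_whiskerRight_assoc, e]
      simp
    exact key _ _ ((inv_mul_hom g⁻¹ g).symm.trans
      ((congrArg (fun a : AutAlg A => (a⁻¹).hom.hom) (inv_mul_cancel g)).trans inv_one_hom))
      f.hom (act_hom f))

/-- A morphism `Y ⟶ T_g V` and its transpose `T_{g⁻¹} Y ⟶ V` have the same underlying morphism.
Being mono, invertible or zero can be read off there, so simplicity of `V` passes to `T_g V`. -/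
instance [HasKernels C] (g : AutAlg A) (V : Mod C A) [Simple V] : Simple ((twist g).obj V) where
  mono_isIso_iff_nonzero {Y} f _ := by
    have : Mono (ofTwist f).hom := mono_hom f
    have h := Simple.mono_isIso_iff_nonzero (ofTwist f)
    have e : ofTwist f = 0 ↔ f = 0 :=
      ⟨fun h => Mod.hom_ext _ _ (show (ofTwist f).hom = 0 from congrArg Mod.Hom.hom h),
        fun h => Mod.hom_ext _ _ (show f.hom = 0 from congrArg Mod.Hom.hom h)⟩
    exact (isIso_iff_hom f).trans ((isIso_iff_hom (ofTwist f)).symm.trans (h.trans (not_congr e)))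

end Preadditive

/-! ### Projections onto relative tensor products and coherence -/

section BimodTensor
variable {C : Type u} [Category.{v} C]

/-- Stands in for rewriting where adjacent objects, such as those underlying `V` and `T_g V`, agree
only after unfolding. -/
lemma comp_eq_of_comp_eq {X₁ X₂ X₃ X₄ : C} {p : X₁ ⟶ X₂} {q : X₂ ⟶ X₃} {r : X₃ ⟶ X₄}
    {p' : X₁ ⟶ X₃} {s : X₁ ⟶ X₄} (h : p ≫ q = p') (h' : p' ≫ r = s) : p ≫ q ≫ r = s := by
  rw [← Category.assoc, h, h']

variable [MonoidalCategory C] {A : C} [MonObj A] [HasCoequalizers C] [RigidCategory C]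

/-- The canonical projection onto the tensor product of bimodules. -/
def bimodπ (P Q : Bimod (Mon.mk A) (Mon.mk A)) :
    P.X ⊗ Q.X ⟶ (P.tensorBimod Q).X :=
  coequalizer.π _ _

lemma bimodπ_whiskerRight {P P' : Bimod (Mon.mk A) (Mon.mk A)} (f : P ⟶ P')
    (Q : Bimod (Mon.mk A) (Mon.mk A)) :
    bimodπ P Q ≫ (Bimod.whiskerRight f Q).hom = f.hom ▷ Q.X ≫ bimodπ P' Q :=
  ι_colimMap _ WalkingParallelPair.one

lemma bimodπ_whiskerLeft (P : Bimod (Mon.mk A) (Mon.mk A)) {Q Q' : Bimod (Mon.mk A) (Mon.mk A)}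
    (f : Q ⟶ Q') :
    bimodπ P Q ≫ (Bimod.whiskerLeft P f).hom = P.X ◁ f.hom ≫ bimodπ P Q' :=
  ι_colimMap _ WalkingParallelPair.one

lemma bimodπ_associator (P Q R : Bimod (Mon.mk A) (Mon.mk A)) :
    bimodπ P Q ▷ R.X ≫ bimodπ (P.tensorBimod Q) R ≫ Bimod.AssociatorBimod.hom P Q R =
      (α_ _ _ _).hom ≫ P.X ◁ bimodπ Q R ≫ bimodπ P (Q.tensorBimod R) :=
  (congrArg (bimodπ P Q ▷ R.X ≫ ·) (coequalizer.π_desc _ _)).trans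
    (π_tensor_id_preserves_coequalizer_inv_desc _ _ _ _)

end BimodTensor

/-! ### The tensor structure of the twist functors -/

section TensorTwist
variable {C : Type u} [Category.{v} C] [MonoidalCategory C]
  [BraidedCategory C] (A : C) [MonObj A] [IsCommMonObj A] [HasCoequalizers C] [RigidCategory C]

lemma tensorMod.hom_ext {M N P : Mod C A} {f g : tensorMod A M N ⟶ P}
    (h : tensorMod.π A M N ≫ f.hom = tensorMod.π A M N ≫ g.hom) : f = g :=
  Mod.hom_ext _ _ ((cancel_epi (tensorMod.π A M N)).1 h)

lemma tensorMod.π_whiskerLeft (M : Mod C A) {N P : Mod C A} (f : N ⟶ P) :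
    tensorMod.π A M N ≫ (M ◁ f).hom = M.X ◁ f.hom ≫ tensorMod.π A M P :=
  ι_colimMap _ WalkingParallelPair.one

lemma tensorMod.π_whiskerRight {M N : Mod C A} (f : M ⟶ N) (P : Mod C A) :
    tensorMod.π A M P ≫ (f ▷ P).hom = f.hom ▷ P.X ≫ tensorMod.π A N P :=
  ι_colimMap _ WalkingParallelPair.one

lemma tensorMod.π_leftUnitor (M : Mod C A) :
    tensorMod.π A (𝟙_ (Mod C A)) M ≫ (λ_ M).hom.hom = act M :=
  comp_eq_of_comp_eq ((bimodπ_whiskerRight (bimodUnitIso A).inv (bimod A M)).trans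
      ((congrArg (· ≫ bimodπ _ (bimod A M)) (id_whiskerRight A M.X)).trans (Category.id_comp _)))
    (coequalizer.π_desc _ _)

lemma tensorMod.π_rightUnitor (M : Mod C A) :
    tensorMod.π A M (𝟙_ (Mod C A)) ≫ (ρ_ M).hom.hom = (β_ M.X A).hom ≫ act M :=
  comp_eq_of_comp_eq ((bimodπ_whiskerLeft (bimod A M) (bimodUnitIso A).inv).trans
      ((congrArg (· ≫ bimodπ (bimod A M) _) (whiskerLeft_id M.X A)).trans (Category.id_comp _)))
    (coequalizer.π_desc _ _)

/-- The associator of modules is that of bimodules composed with `bimodTensorIso` on either side.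
These isomorphisms are identities in `C`, so they are absorbed by the projections and the bimodule
identity remains. -/
lemma tensorMod.π_associator (M N P : Mod C A) :
    tensorMod.π A M N ▷ P.X ≫ tensorMod.π A (M ⊗ N) P ≫ (α_ M N P).hom.hom =
      (α_ M.X N.X P.X).hom ≫ M.X ◁ tensorMod.π A N P ≫ tensorMod.π A M (N ⊗ P) := by
  have h₁ : tensorMod.π A (M ⊗ N) P ≫
      (Bimod.whiskerRight (bimodTensorIso A M N).inv (bimod A P)).hom =
      bimodπ ((bimod A M).tensorBimod (bimod A N)) (bimod A P) :=
    (bimodπ_whiskerRight (bimodTensorIso A M N).inv (bimod A P)).trans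
      ((congrArg (· ≫ bimodπ _ (bimod A P)) (id_whiskerRight _ P.X)).trans (Category.id_comp _))
  have h₂ : bimodπ (bimod A M) ((bimod A N).tensorBimod (bimod A P)) ≫
      (Bimod.whiskerLeft (bimod A M) (bimodTensorIso A N P).hom).hom = tensorMod.π A M (N ⊗ P) :=
    (bimodπ_whiskerLeft (bimod A M) (bimodTensorIso A N P).hom).trans
      ((congrArg (· ≫ bimodπ (bimod A M) _) (whiskerLeft_id M.X _)).trans (Category.id_comp _))
  have h₃ := bimodπ_associator (bimod A M) (bimod A N) (bimod A P)
  have key {X₀ X₁ X₂ X₃ X₄ X₅ Y₁ Y₂ : C} {a : X₀ ⟶ X₁} {b : X₁ ⟶ X₂} {c : X₂ ⟶ X₃} {d : X₃ ⟶ X₄}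
      {e : X₄ ⟶ X₅} {b' : X₁ ⟶ X₃} {x : X₀ ⟶ Y₁} {y : Y₁ ⟶ Y₂} {z : Y₂ ⟶ X₄} {z' : Y₂ ⟶ X₅}
      (h₁ : b ≫ c = b') (h₂ : z ≫ e = z') (h₃ : a ≫ b' ≫ d = x ≫ y ≫ z) :
      a ≫ b ≫ c ≫ d ≫ e = x ≫ y ≫ z' := by
    rw [← h₂, reassoc_of% h₁, reassoc_of% h₃]
  exact key h₁ h₂ h₃

/-- The morphism out of `V ⊗_A W` induced by a balanced morphism. -/
def tensorMod.descHom {M N : Mod C A} {Y : C} (k : M.X ⊗ N.X ⟶ Y)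
    (bal : ((β_ M.X A).hom ≫ act M) ▷ N.X ≫ k = (α_ _ _ _).hom ≫ M.X ◁ act N ≫ k) :
    (tensorMod A M N).X ⟶ Y :=
  coequalizer.desc k (bal.trans (Category.assoc _ _ _).symm)

lemma tensorMod.π_descHom {M N : Mod C A} {Y : C} (k : M.X ⊗ N.X ⟶ Y)
    (bal : ((β_ M.X A).hom ≫ act M) ▷ N.X ≫ k = (α_ _ _ _).hom ≫ M.X ◁ act N ≫ k) :
    tensorMod.π A M N ≫ tensorMod.descHom A k bal = k :=
  coequalizer.π_desc _ _

instance (X : C) (M N : Mod C A) : Epi (X ◁ tensorMod.π A M N) :=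
  inferInstanceAs (Epi ((tensorLeft X).map (tensorMod.π A M N)))

instance (X : C) (M N : Mod C A) : Epi (tensorMod.π A M N ▷ X) :=
  inferInstanceAs (Epi ((tensorRight X).map (tensorMod.π A M N)))

/-- The module morphism out of `V ⊗_A W` induced by a balanced, linear morphism. -/
def tensorMod.desc {M N P : Mod C A} (k : M.X ⊗ N.X ⟶ P.X)
    (bal : ((β_ M.X A).hom ≫ act M) ▷ N.X ≫ k = (α_ _ _ _).hom ≫ M.X ◁ act N ≫ k)
    (lin : (α_ _ _ _).inv ≫ act M ▷ N.X ≫ k = A ◁ k ≫ act P) : M ⊗ N ⟶ P :=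
  mkHom (M := tensorMod A M N) (tensorMod.descHom A k bal) (by
    refine (cancel_epi (A ◁ tensorMod.π A M N)).1 ?_
    rw [← Category.assoc, tensorMod.π_smul, ← MonoidalCategory.whiskerLeft_comp_assoc,
      tensorMod.π_descHom, ← lin]
    simp only [Category.assoc, tensorMod.π_descHom])

lemma tensorMod.π_desc {M N P : Mod C A} (k : M.X ⊗ N.X ⟶ P.X)
    (bal : ((β_ M.X A).hom ≫ act M) ▷ N.X ≫ k = (α_ _ _ _).hom ≫ M.X ◁ act N ≫ k)
    (lin : (α_ _ _ _).inv ≫ act M ▷ N.X ≫ k = A ◁ k ≫ act P) :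
    tensorMod.π A M N ≫ (tensorMod.desc A k bal lin).hom = k :=
  tensorMod.π_descHom A k bal

variable {A}

/-- The tensor structure `T_g V ⊗_A T_g W ⟶ T_g (V ⊗_A W)`. -/
def twistTensor (g : AutAlg A) (V W : Mod C A) :
    (twist g).obj V ⊗ (twist g).obj W ⟶ (twist g).obj (V ⊗ W) :=
  tensorMod.desc A (tensorMod.π A V W)
    (by
      -- Naturality moves `σ` across the braiding, so both sides are the untwisted balancing
      -- condition precomposed with `σ` on the middle factor `A`. Invertibility of `σ` plays no role
      -- here.
      have key (σ : A ⟶ A) : ((β_ V.X A).hom ≫ σ ▷ V.X ≫ act V) ▷ W.X ≫ tensorMod.π A V W =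
          (α_ V.X A W.X).hom ≫ V.X ◁ (σ ▷ W.X ≫ act W) ≫ tensorMod.π A V W := by
        rw [← BraidedCategory.braiding_naturality_right_assoc, comp_whiskerRight, Category.assoc,
          tensorMod.condition]
        simp
      exact key (g⁻¹).hom.hom)
    (by
      have key (σ : A ⟶ A) : (α_ A V.X W.X).inv ≫ (σ ▷ V.X ≫ act V) ▷ W.X ≫ tensorMod.π A V W =
          A ◁ tensorMod.π A V W ≫ σ ▷ _ ≫ act (tensorMod A V W) := by
        rw [whisker_exchange_assoc, tensorMod.π_smul]
        simp
      exact key (g⁻¹).hom.hom)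

lemma π_twistTensor (g : AutAlg A) (V W : Mod C A) :
    tensorMod.π A ((twist g).obj V) ((twist g).obj W) ≫ (twistTensor g V W).hom =
      tensorMod.π A V W :=
  tensorMod.π_desc A _ _ _

/-- The inverse of the tensor structure. -/
def twistTensorInv (g : AutAlg A) (V W : Mod C A) :
    (V ⊗ W : Mod C A).X ⟶ ((twist g).obj V ⊗ (twist g).obj W : Mod C A).X :=
  tensorMod.descHom A (tensorMod.π A ((twist g).obj V) ((twist g).obj W))
    (by
      have key {Y : C} (σ τ : A ⟶ A) (e : τ ≫ σ = 𝟙 A) (p : V.X ⊗ W.X ⟶ Y)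
          (h : ((β_ V.X A).hom ≫ σ ▷ V.X ≫ act V) ▷ W.X ≫ p =
          (α_ V.X A W.X).hom ≫ V.X ◁ (σ ▷ W.X ≫ act W) ≫ p) :
          ((β_ V.X A).hom ≫ act V) ▷ W.X ≫ p = (α_ V.X A W.X).hom ≫ V.X ◁ act W ≫ p := by
        -- Precomposing with `τ` on the middle factor cancels `σ` from both actions, which turns
        -- twisted balancing into ordinary balancing.
        have h' := congrArg ((V.X ◁ τ) ▷ W.X ≫ ·) h
        beta_reduce at h'
        rw [← comp_whiskerRight_assoc, BraidedCategory.braiding_naturality_right_assoc,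
          ← comp_whiskerRight_assoc, e, associator_naturality_middle_assoc,
          ← MonoidalCategory.whiskerLeft_comp_assoc, ← comp_whiskerRight_assoc, e] at h'
        simpa using h'
      exact key _ (g.hom.hom) (congrArg Mon.Hom.hom g.hom_inv_id) _
        (tensorMod.condition A ((twist g).obj V) ((twist g).obj W)))

instance (g : AutAlg A) (V W : Mod C A) : IsIso (twistTensor g V W).hom :=
  ⟨twistTensorInv g V W,
    (cancel_epi (tensorMod.π A ((twist g).obj V) ((twist g).obj W))).1 
      (comp_eq_of_comp_eq (π_twistTensor g V W)
        ((tensorMod.π_descHom A _ _).trans (Category.comp_id _).symm)),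
    (cancel_epi (tensorMod.π A V W)).1 ((Category.assoc _ _ _).symm.trans
      ((congrArg (· ≫ (twistTensor g V W).hom) (tensorMod.π_descHom A _ _)).trans
        ((π_twistTensor g V W).trans (Category.comp_id _).symm)))⟩

/-- The unit isomorphism `g⁻¹ : A ⟶ T_g A`. -/
def twistUnit (g : AutAlg A) : 𝟙_ (Mod C A) ⟶ (twist g).obj (𝟙_ (Mod C A)) :=
  mkHom (M := Mod.regular A) (N := (twist g).obj (Mod.regular A)) (g⁻¹).hom.hom (by
    have h := IsMonHom.mul_hom (f := (g⁻¹).hom.hom)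
    change μ[A] ≫ (g⁻¹).hom.hom = A ◁ (g⁻¹).hom.hom ≫ (g⁻¹).hom.hom ▷ A ≫ μ[A]
    refine h.trans ?_
    rw [tensorHom_def']
    exact Category.assoc _ _ _)

end TensorTwist

/-! ### The twists as a tensor action -/

section TwistMonoidal
variable {C : Type u} [Category.{v} C] [MonoidalCategory C]
  [BraidedCategory C] {A : C} [MonObj A] [IsCommMonObj A] [HasCoequalizers C] [RigidCategory C]

lemma twistTensor_natural_left (g : AutAlg A) {V W : Mod C A} (f : V ⟶ W) (X : Mod C A) :
    (twist g).map f ▷ (twist g).obj X ≫ twistTensor g W X =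
      twistTensor g V X ≫ (twist g).map (f ▷ X) :=
  tensorMod.hom_ext A ((comp_eq_of_comp_eq (tensorMod.π_whiskerRight A ((twist g).map f) ((twist g).obj X))
    ((Category.assoc _ _ _).trans (congrArg (f.hom ▷ X.X ≫ ·) (π_twistTensor g W X)))).trans
    (comp_eq_of_comp_eq (π_twistTensor g V X) (tensorMod.π_whiskerRight A f X)).symm)

lemma twistTensor_natural_right (g : AutAlg A) {V W : Mod C A} (X : Mod C A) (f : V ⟶ W) :
    (twist g).obj X ◁ (twist g).map f ≫ twistTensor g X W =
      twistTensor g X V ≫ (twist g).map (X ◁ f) :=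
  tensorMod.hom_ext A ((comp_eq_of_comp_eq (tensorMod.π_whiskerLeft A ((twist g).obj X) ((twist g).map f))
    ((Category.assoc _ _ _).trans (congrArg (X.X ◁ f.hom ≫ ·) (π_twistTensor g X W)))).trans
    (comp_eq_of_comp_eq (π_twistTensor g X V) (tensorMod.π_whiskerLeft A X f)).symm)

/-- After precomposition with the epimorphism from the threefold product in `C`, the tensor
structures turn twisted projections into untwisted ones, and both sides reduce to the associator
identity for `X`, `Y`, `Z`. -/
lemma twistTensor_associativity (g : AutAlg A) (X Y Z : Mod C A) :
    twistTensor g X Y ▷ (twist g).obj Z ≫ twistTensor g (X ⊗ Y) Z ≫ (twist g).map (α_ X Y Z).hom =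
      (α_ ((twist g).obj X) ((twist g).obj Y) ((twist g).obj Z)).hom ≫
        (twist g).obj X ◁ twistTensor g Y Z ≫ twistTensor g X (Y ⊗ Z) := by
  have a₁ := tensorMod.π_whiskerRight A (twistTensor g X Y) ((twist g).obj Z)
  have a₂ := π_twistTensor g (X ⊗ Y) Z
  have a₃ := congrArg (· ▷ Z.X) (π_twistTensor g X Y)
  have a₄ := tensorMod.π_associator A X Y Z
  have b₁ := tensorMod.π_associator A ((twist g).obj X) ((twist g).obj Y) ((twist g).obj Z)
  have b₂ := tensorMod.π_whiskerLeft A ((twist g).obj X) (twistTensor g Y Z)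
  have b₃ := congrArg (X.X ◁ ·) (π_twistTensor g Y Z)
  have b₄ := π_twistTensor g X (Y ⊗ Z)
  refine tensorMod.hom_ext A ((cancel_epi
    (tensorMod.π A ((twist g).obj X) ((twist g).obj Y) ▷ Z.X)).1 ?_)
  have key {X Y Z XY YZ XYZ XYZ' T YZT S S' S'' S₁ : C} {p : X ⊗ Y ⟶ XY} {p' : XY ⊗ Z ⟶ XYZ}
      {t : XY ⟶ T} {t' : XYZ ⟶ S} {q : T ⊗ Z ⟶ S} {s : S ⟶ S'} {q' : T ⊗ Z ⟶ S'} {a : S' ⟶ S''}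
      {r : X ⊗ Y ⟶ T} {rr : Y ⊗ Z ⟶ YZT} {x : X ⊗ YZT ⟶ S''}
      {b : XYZ ⟶ XYZ'} {y : Y ⊗ Z ⟶ YZ} {y' : X ⊗ YZ ⟶ XYZ'} {u : YZ ⟶ YZT} {u' : XYZ' ⟶ S₁}
      {z : X ⊗ YZT ⟶ S₁} {v : S₁ ⟶ S''}
      (a₁ : p' ≫ t' = t ▷ Z ≫ q) (a₂ : q ≫ s = q') (a₃ : (p ≫ t) ▷ Z = r ▷ Z)
      (a₄ : r ▷ Z ≫ q' ≫ a = (α_ X Y Z).hom ≫ X ◁ rr ≫ x)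
      (b₁ : p ▷ Z ≫ p' ≫ b = (α_ X Y Z).hom ≫ X ◁ y ≫ y')
      (b₂ : y' ≫ u' = X ◁ u ≫ z) (b₃ : X ◁ (y ≫ u) = X ◁ rr) (b₄ : z ≫ v = x) :
      p ▷ Z ≫ p' ≫ t' ≫ s ≫ a = p ▷ Z ≫ p' ≫ b ≫ u' ≫ v := by
    rw [reassoc_of% a₁, reassoc_of% a₂, ← comp_whiskerRight_assoc, a₃, a₄, reassoc_of% b₁,
      reassoc_of% b₂, b₄, ← MonoidalCategory.whiskerLeft_comp_assoc, b₃]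
  exact key a₁ a₂ a₃ a₄ b₁ b₂ b₃ b₄

lemma twistTensor_left_unitality (g : AutAlg A) (X : Mod C A) :
    (λ_ ((twist g).obj X)).hom = twistUnit g ▷ (twist g).obj X ≫
      twistTensor g (𝟙_ (Mod C A)) X ≫ (twist g).map (λ_ X).hom :=
  tensorMod.hom_ext A ((tensorMod.π_leftUnitor A ((twist g).obj X)).trans
    (comp_eq_of_comp_eq (tensorMod.π_whiskerRight A (twistUnit g) ((twist g).obj X))
      ((Category.assoc _ _ _).trans (congrArg ((g⁻¹).hom.hom ▷ X.X ≫ ·)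
        (comp_eq_of_comp_eq (π_twistTensor g (𝟙_ (Mod C A)) X) (tensorMod.π_leftUnitor A X))))).symm)

lemma twistTensor_right_unitality (g : AutAlg A) (X : Mod C A) :
    (ρ_ ((twist g).obj X)).hom = (twist g).obj X ◁ twistUnit g ≫
      twistTensor g X (𝟙_ (Mod C A)) ≫ (twist g).map (ρ_ X).hom :=
  tensorMod.hom_ext A ((tensorMod.π_rightUnitor A ((twist g).obj X)).trans
    ((BraidedCategory.braiding_naturality_right_assoc X.X (g⁻¹).hom.hom (act X)).symm.trans
    (comp_eq_of_comp_eq (tensorMod.π_whiskerLeft A ((twist g).obj X) (twistUnit g))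
      ((Category.assoc _ _ _).trans (congrArg (X.X ◁ (g⁻¹).hom.hom ≫ ·)
        (comp_eq_of_comp_eq (π_twistTensor g X (𝟙_ (Mod C A)))
          (tensorMod.π_rightUnitor A X))))).symm))

instance (g : AutAlg A) : IsIso (twistUnit g).hom :=
  inferInstanceAs (IsIso (g⁻¹).hom.hom)

/-- The tensor structure of the twist functor `T_g`. -/
instance twistMonoidal (g : AutAlg A) : (twist g).Monoidal :=
  Functor.CoreMonoidal.toMonoidal
    { εIso := mkIso (twistUnit g)
      μIso := fun V W => mkIso (twistTensor g V W)
      μIso_hom_natural_left := twistTensor_natural_left g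
      μIso_hom_natural_right := twistTensor_natural_right g
      associativity := twistTensor_associativity g
      left_unitality := twistTensor_left_unitality g
      right_unitality := twistTensor_right_unitality g }

lemma tensorMod.π_tensorHom {M M' N N' : Mod C A} (f : M ⟶ M') (k : N ⟶ N') :
    tensorMod.π A M N ≫ (f ⊗ₘ k).hom = (f.hom ⊗ₘ k.hom) ≫ tensorMod.π A M' N' := by
  rw [MonoidalCategory.tensorHom_def f k]
  refine (comp_eq_of_comp_eq (tensorMod.π_whiskerRight A f N) ?_)
  rw [Category.assoc]
  refine (congrArg (f.hom ▷ N.X ≫ ·) (tensorMod.π_whiskerLeft A M' k)).trans ?_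
  rw [MonoidalCategory.tensorHom_def, Category.assoc]

/-- The unit condition is `(gh)⁻¹ = h⁻¹ g⁻¹`; for the tensor condition, both sides become the plain
projection `X ⊗ Y ⟶ X ⊗_A Y` once precomposed with the projection. -/
instance (g h : AutAlg A) : NatTrans.IsMonoidal (twistMulIso g h).hom where
  unit := Mod.hom_ext _ _ ((Category.comp_id _).trans (inv_mul_hom g h))
  tensor X Y := tensorMod.hom_ext A (by
    refine (comp_eq_of_comp_eq (π_twistTensor (g * h) X Y) (Category.comp_id _)).trans ?_
    refine Eq.symm (comp_eq_of_comp_eq (tensorMod.π_tensorHom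
      ((twistMulIso g h).hom.app X) ((twistMulIso g h).hom.app Y)) ?_)
    refine (congrArg (· ≫ _) ((congrArg (· ≫ _) (id_tensorHom_id X.X Y.X)).trans
      (Category.id_comp _))).trans ?_
    exact comp_eq_of_comp_eq (π_twistTensor g ((twist h).obj X) ((twist h).obj Y))
      (π_twistTensor h X Y))

instance : NatTrans.IsMonoidal (twistOneIso (A := A)).hom where
  unit := Mod.hom_ext _ _ ((Category.comp_id _).trans inv_one_hom)
  tensor X Y := tensorMod.hom_ext A (by
    refine (comp_eq_of_comp_eq (π_twistTensor 1 X Y) (Category.comp_id _)).trans ?_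
    refine Eq.symm (comp_eq_of_comp_eq (tensorMod.π_tensorHom
      ((twistOneIso (A := A)).hom.app X) ((twistOneIso (A := A)).hom.app Y)) ?_)
    refine (congrArg (· ≫ _) ((congrArg (· ≫ _) (id_tensorHom_id X.X Y.X)).trans
      (Category.id_comp _))).trans ?_
    exact Category.comp_id _)

/-- The strict action of `Aut(A)` on the category of modules by tensor functors. -/
def twistTensorAction : TensorGroupAction (fun g : AutAlg A => twist g) where
  toGroupAction := twistAction
  monoidal := twistMonoidal
  mulIso_monoidal g h := inferInstanceAs (NatTrans.IsMonoidal (twistMulIso g h).hom)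
  oneIso_monoidal := inferInstanceAs (NatTrans.IsMonoidal twistOneIso.hom)

end TwistMonoidal

/-! ### Injectivity of all objects of a fusion category -/

section Fusion
variable {C : Type u} [Category.{v} C] [Abelian C] [Linear ℂ C] [MonoidalCategory C] [IsFusion C]

/-- Pushing the monomorphism out along the map to `S` embeds `S` in a sum of simples. Some
coordinate of this embedding is nonzero, hence invertible by Schur, and so yields a retraction onto
`S`. -/
lemma injective_of_simple (S : C) [Simple S] : Injective S where
  factors {X Y} g f _ := by
    obtain ⟨n, T, hT, ⟨e⟩⟩ := IsFusion.semisimple (pushout f g)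
    have : HasFiniteBiproducts C := Abelian.hasFiniteBiproducts
    let e' : pushout f g ≅ ⨁ T := e ≪≫ (biproduct.isoCoproduct T).symm
    have hm : Mono (pushout.inr f g ≫ e'.hom) := inferInstance
    have h0 : pushout.inr f g ≫ e'.hom ≠ 0 := by
      intro h
      refine id_nonzero S ((cancel_mono (pushout.inr f g ≫ e'.hom)).1 ?_)
      rw [h, comp_zero, comp_zero]
    obtain ⟨k, hk⟩ : ∃ k, (pushout.inr f g ≫ e'.hom) ≫ biproduct.π T k ≠ 0 := by
      by_contra! h
      exact h0 (biproduct.hom_ext _ _ fun k => by rw [h k, zero_comp])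
    have := hT k
    have hi : IsIso ((pushout.inr f g ≫ e'.hom) ≫ biproduct.π T k) := isIso_of_hom_simple hk
    refine ⟨pushout.inl f g ≫ e'.hom ≫ biproduct.π T k ≫
      inv ((pushout.inr f g ≫ e'.hom) ≫ biproduct.π T k), ?_⟩
    rw [pushout.condition_assoc]
    have := IsIso.hom_inv_id ((pushout.inr f g ≫ e'.hom) ≫ biproduct.π T k)
    simp only [Category.assoc] at this ⊢
    rw [this, Category.comp_id]

/-- Every object of a fusion category is injective. -/
lemma injective_of_isFusion (X : C) : Injective X := by
  obtain ⟨n, T, hT, ⟨e⟩⟩ := IsFusion.semisimple X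
  have : HasFiniteBiproducts C := Abelian.hasFiniteBiproducts
  have hT' (j : Fin n) : Injective (T j) := have := hT j; injective_of_simple (T j)
  refine Injective.of_iso (e ≪≫ (biproduct.isoCoproduct T).symm).symm ⟨fun {Y Z} g f _ =>
    ⟨biproduct.lift fun j => Injective.factorThru (g ≫ biproduct.π T j) f,
      biproduct.hom_ext _ _ fun j => ?_⟩⟩
  rw [Category.assoc, biproduct.lift_π, Injective.comp_factorThru]

end Fusion

/-! ### Averaging over the separability element and Maschke's theorem -/

section Frobenius
variable {C : Type u} [Category.{v} C] [Abelian C] [Linear ℂ C] [MonoidalCategory C]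
  {A : C} [MonObj A] [ComonObj A]

/-- `Δ(1)·a = Δ(a)`. Together with `a·Δ(1) = Δ(a)` below, this says that `Δ(1)` commutes with `A`,
which is what makes averages `A`-linear. -/
lemma unit_comul_mul (hA : IsStronglySeparableFrobenius A) :
    (λ_ A).inv ≫ (η[A] ≫ ComonObj.comul) ▷ A ≫ (α_ A A A).hom ≫ A ◁ μ[A] = ComonObj.comul := by
  rw [comp_whiskerRight, Category.assoc, hA.frobenius_right, MonObj.one_mul_assoc,
    Iso.inv_hom_id_assoc]

lemma mul_unit_comul (hA : IsStronglySeparableFrobenius A) :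
    (ρ_ A).inv ≫ A ◁ (η[A] ≫ ComonObj.comul) ≫ (α_ A A A).inv ≫ μ[A] ▷ A = ComonObj.comul := by
  rw [MonoidalCategory.whiskerLeft_comp, Category.assoc, hA.frobenius_left, MonObj.mul_one_assoc,
    Iso.inv_hom_id_assoc]

/-- The average of a morphism of `C` with respect to the separability element of `A`. -/
def averageHom {M N : Mod C A} (r : M.X ⟶ N.X) : M.X ⟶ N.X :=
  (λ_ M.X).inv ≫ (η[A] ≫ ComonObj.comul) ▷ M.X ≫ (α_ A A M.X).hom ≫ A ◁ (act M ≫ r) ≫ act N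

/-- With `Δ(1) = ∑ e_i ⊗ e^i` the average is `v ↦ ∑ e_i r(e^i v)`. Replacing `v` by `a v` puts
`Δ(1)·a = Δ(a)` in place of `Δ(1)`; acting by `a` afterwards, as in the next lemma, gives the same
expression through `a·Δ(1) = Δ(a)`. -/
lemma act_averageHom (hA : IsStronglySeparableFrobenius A) {M N : Mod C A} (r : M.X ⟶ N.X) :
    act M ≫ averageHom r =
      (ComonObj.comul : A ⟶ A ⊗ A) ▷ M.X ≫ (α_ A A M.X).hom ≫ A ◁ (act M ≫ r) ≫ act N := by
  have h := ModObj.mul_smul_self A M.X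
  have h' (d : 𝟙_ C ⟶ A ⊗ A) : act M ≫ (λ_ M.X).inv ≫ d ▷ M.X ≫ (α_ A A M.X).hom ≫ A ◁ act M =
      ((λ_ A).inv ≫ d ▷ A ≫ (α_ A A A).hom ≫ A ◁ μ[A]) ▷ M.X ≫ (α_ A A M.X).hom ≫ A ◁ act M := by
    have h₂ : (A ◁ μ[A]) ▷ M.X ≫ (α_ A A M.X).hom ≫ A ◁ act M =
        (α_ A (A ⊗ A) M.X).hom ≫ A ◁ (α_ A A M.X).hom ≫ A ◁ A ◁ act M ≫ A ◁ act M := by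
      rw [associator_naturality_middle_assoc, ← MonoidalCategory.whiskerLeft_comp, h]
      simp
    simp only [comp_whiskerRight, Category.assoc]
    rw [h₂, leftUnitor_inv_naturality_assoc, whisker_exchange_assoc]
    monoidal
  replace h' := h' (η[A] ≫ ComonObj.comul)
  rw [unit_comul_mul hA] at h'
  have := congrArg (· ≫ A ◁ r ≫ act N) h'
  simpa [averageHom] using this

lemma whiskerLeft_averageHom (hA : IsStronglySeparableFrobenius A) {M N : Mod C A}
    (r : M.X ⟶ N.X) : A ◁ averageHom r ≫ act N =
      (ComonObj.comul : A ⟶ A ⊗ A) ▷ M.X ≫ (α_ A A M.X).hom ≫ A ◁ (act M ≫ r) ≫ act N := by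
  have h := ModObj.mul_smul_self_flip (M := A) (X := N.X)
  rw [← mul_unit_comul hA]
  unfold averageHom
  simp only [MonoidalCategory.whiskerLeft_comp, Category.assoc, comp_whiskerRight]
  rw [h, associator_inv_naturality_right_assoc, associator_inv_naturality_right_assoc,
    whisker_exchange_assoc, whisker_exchange_assoc, associator_naturality_left_assoc]
  monoidal

end Frobenius

section Average
variable {C : Type u} [Category.{v} C] [Abelian C] [Linear ℂ C] [MonoidalCategory C]
  [MonoidalPreadditive C] [MonoidalLinear ℂ C] {A : C} [MonObj A] [ComonObj A]

/-- The averaged morphism is a module morphism. -/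
def average (hA : IsStronglySeparableFrobenius A) {M N : Mod C A} (r : M.X ⟶ N.X) : M ⟶ N :=
  mkHom (averageHom r) ((act_averageHom hA r).trans (whiskerLeft_averageHom hA r).symm)

/-- Linearity of `f` gives `∑ e_i r(e^i f(n)) = ∑ e_i r(f(e^i n)) = ∑ e_i e^i n`, and `∑ e_i e^i =
c` by strong separability. -/
lemma comp_averageHom {c : ℂ} (hc : (ComonObj.comul ≫ μ[A] : A ⟶ A) = c • 𝟙 A)
    {M N : Mod C A} (f : N ⟶ M) (r : M.X ⟶ N.X) (h : f.hom ≫ r = 𝟙 N.X) :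
    f.hom ≫ averageHom r = c • 𝟙 N.X := by
  have h₁ : A ◁ f.hom ≫ act M ≫ r = act N := by
    rw [← Category.assoc, ← act_hom, Category.assoc, h, Category.comp_id]
  have h₂ := ModObj.mul_smul_self A N.X
  unfold averageHom
  rw [leftUnitor_inv_naturality_assoc, whisker_exchange_assoc,
    associator_naturality_right_assoc, ← MonoidalCategory.whiskerLeft_comp_assoc, h₁, ← h₂,
    ← comp_whiskerRight_assoc, Category.assoc, hc, Linear.comp_smul, Category.comp_id,
    MonoidalLinear.smul_whiskerRight, Linear.smul_comp, ModObj.one_smul_self, Linear.comp_smul,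
    Iso.inv_hom_id]

variable [IsFusion C]

/-- Maschke's theorem: monomorphisms of modules over a strongly separable algebra split. -/
lemma exists_retraction (hA : IsStronglySeparableFrobenius A) {M N : Mod C A} (f : N ⟶ M)
    [Mono f] : ∃ r : M ⟶ N, f ≫ r = 𝟙 N := by
  have : Mono f.hom := mono_hom f
  have := injective_of_isFusion N.X
  obtain ⟨c, hc, hmul⟩ := hA.mul_comul
  refine ⟨c⁻¹ • average hA (Injective.factorThru (𝟙 N.X) f.hom), Mod.hom_ext _ _ ?_⟩
  have := comp_averageHom hmul f _ (Injective.comp_factorThru (𝟙 N.X) f.hom)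
  change f.hom ≫ (c⁻¹ • averageHom _) = 𝟙 _
  rw [Linear.comp_smul, this, smul_smul, inv_mul_cancel₀ hc, one_smul]

end Average

/-! ### Semisimplicity of modules -/

section Semisimple
variable {C : Type u} [Category.{v} C] [Preadditive C] [MonoidalCategory C]
  [MonoidalPreadditive C] {A : C} [MonObj A]

/-- The identity of `M` factors, as a finite sum, through simple modules. -/
def IsSemisimple (M : Mod C A) : Prop :=
  ∃ (J : Type) (_ : Fintype J) (V : J → Mod C A) (p : ∀ j, M ⟶ V j) (i : ∀ j, V j ⟶ M),
    (∀ j, Simple (V j)) ∧ ∑ j, p j ≫ i j = 𝟙 M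

lemma IsSemisimple.of_add {M Y Z : Mod C A} (hY : IsSemisimple Y) (hZ : IsSemisimple Z)
    {f : Y ⟶ M} {r : M ⟶ Y} {k : Z ⟶ M} {q : M ⟶ Z} (h : r ≫ f + q ≫ k = 𝟙 M) :
    IsSemisimple M := by
  obtain ⟨J, _, V, p, i, hV, h₁⟩ := hY
  obtain ⟨K, _, W, p', i', hW, h₂⟩ := hZ
  refine ⟨J ⊕ K, inferInstance, Sum.elim V W, fun j => j.rec (fun j => r ≫ p j) (fun j => q ≫ p' j),
    fun j => j.rec (fun j => i j ≫ f) (fun j => i' j ≫ k), fun j => j.rec hV hW, ?_⟩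
  have e₁ : ∑ j, (r ≫ p j) ≫ i j ≫ f = r ≫ f := by
    simpa [Preadditive.sum_comp, Preadditive.comp_sum] using congrArg (fun t => r ≫ t ≫ f) h₁
  have e₂ : ∑ j, (q ≫ p' j) ≫ i' j ≫ k = q ≫ k := by
    simpa [Preadditive.sum_comp, Preadditive.comp_sum] using congrArg (fun t => q ≫ t ≫ k) h₂
  rw [Fintype.sum_sum_type, ← h, ← e₁, ← e₂]
  rfl

end Semisimple

section Maschke
variable {C : Type u} [Category.{v} C] [Abelian C] [Linear ℂ C] [MonoidalCategory C]
  [MonoidalPreadditive C] [MonoidalLinear ℂ C] [IsFusion C] {A : C} [MonObj A]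

instance (M N : Mod C A) : FiniteDimensional ℂ (M ⟶ N) :=
  have := IsFusion.finite_hom M.X N.X
  Module.Finite.of_injective
    ({ toFun := fun f => f.hom, map_add' := add_hom, map_smul' := smul_hom } :
      (M ⟶ N) →ₗ[ℂ] (M.X ⟶ N.X)) (fun _ _ h => Mod.hom_ext _ _ h)

/-- The embedding `a ↦ r ≫ a ≫ f` of endomorphism spaces misses the identity, so its image is a
proper subspace. The dimension of `End M` serves as the measure for the induction splitting `M`. -/
lemma finrank_end_lt_of_retract {M Y : Mod C A} {f : Y ⟶ M} {r : M ⟶ Y} (h : f ≫ r = 𝟙 Y)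
    (hne : ∀ a : Y ⟶ Y, r ≫ a ≫ f ≠ 𝟙 M) :
    Module.finrank ℂ (Y ⟶ Y) < Module.finrank ℂ (M ⟶ M) := by
  let F : (Y ⟶ Y) →ₗ[ℂ] (M ⟶ M) :=
    { toFun := fun a => r ≫ a ≫ f
      map_add' := fun a b => by simp
      map_smul' := fun c a => by simp }
  have hF : Function.Injective F := fun a b e => by
    have e' : f ≫ (r ≫ a ≫ f) ≫ r = f ≫ (r ≫ b ≫ f) ≫ r := congrArg (fun t => f ≫ t ≫ r) e
    simpa [h, reassoc_of% h] using e'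
  rw [← LinearMap.finrank_range_of_inj hF]
  refine Submodule.finrank_lt fun e => ?_
  obtain ⟨a, ha⟩ : 𝟙 M ∈ LinearMap.range F := e ▸ Submodule.mem_top
  exact hne a ha

/-- Modules over a strongly separable Frobenius algebra are semisimple. -/
theorem isSemisimple [ComonObj A] (hA : IsStronglySeparableFrobenius A) (M : Mod C A) :
    IsSemisimple M := by
  induction hn : Module.finrank ℂ (M ⟶ M) using Nat.strong_induction_on generalizing M with
  | _ n ih =>
  by_cases h0 : 𝟙 M = 0
  · exact ⟨Empty, inferInstance, Empty.elim, fun j => j.elim, fun j => j.elim, fun j => j.elim,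
      by simp [h0]⟩
  by_cases hs : Simple M
  · exact ⟨Unit, inferInstance, fun _ => M, fun _ => 𝟙 M, fun _ => 𝟙 M, fun _ => hs, by simp⟩
  obtain ⟨Y, f, _, hi, hf⟩ : ∃ (Y : Mod C A) (f : Y ⟶ M), Mono f ∧ ¬ IsIso f ∧ f ≠ 0 := by
    by_contra! h
    refine hs ⟨fun {Y} f _ => ⟨fun _ e => h0 ?_, fun e => ?_⟩⟩
    · exact (IsIso.inv_hom_id f).symm.trans ((congrArg (inv f ≫ ·) e).trans comp_zero)
    · by_contra hi
      exact e (h Y f inferInstance hi)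
  obtain ⟨r, hr⟩ := exists_retraction hA f
  let k := kernelMod.incl r
  have hk : k ≫ r = 0 := kernelMod.condition r
  let q : M ⟶ kernelMod r := kernelMod.lift r (𝟙 M - r ≫ f) (by simp [hr])
  have hq : q ≫ k = 𝟙 M - r ≫ f := kernelMod.lift_incl _ _ _
  have hkq : k ≫ q = 𝟙 _ := (cancel_mono k).1 (by
    rw [Category.assoc, hq]; simp [reassoc_of% hk])
  have hfq : f ≫ q = 0 := (cancel_mono k).1 (by
    rw [Category.assoc, hq]; simp [reassoc_of% hr])
  refine (ih _ ?_ Y rfl).of_add (f := f) (r := r) (ih _ ?_ (kernelMod r) rfl) (k := k) (q := q) ?_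
  · rw [← hn]
    -- If `𝟙 M` factored through `Y` in this way, the complement inclusion `k` would vanish because
    -- `k ≫ r = 0`, and `f` would be invertible.
    refine finrank_end_lt_of_retract hr fun a ha => hi ?_
    have hk0 : k = 0 := by rw [← Category.comp_id k, ← ha, reassoc_of% hk, zero_comp]
    refine ⟨r, hr, ?_⟩
    rw [hk0, comp_zero] at hq
    exact (sub_eq_zero.1 hq.symm).symm
  · rw [← hn]
    refine finrank_end_lt_of_retract hkq fun a ha => hf ?_
    rw [← Category.comp_id f, ← ha, reassoc_of% hfq, zero_comp]
  · rw [hq]; abel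

end Maschke

/-! ### Existence of systems of representatives -/

section ExistsRepresentatives
variable {C : Type u} [Category.{v} C] [Preadditive C] [MonoidalCategory C] [MonoidalPreadditive C]
  {A : C} [MonObj A]

/-- The module structure transported along an isomorphism of `C`. -/
def transportMod (M : Mod C A) {X : C} (e : M.X ≅ X) : Mod C A :=
  letI : ModObj A X :=
    { smul := A ◁ e.inv ≫ act M ≫ e.hom
      one_smul := by
        have h := ModObj.one_smul_self A M.X
        change η[A] ▷ X ≫ A ◁ e.inv ≫ act M ≫ e.hom = (λ_ X).hom
        rw [← whisker_exchange_assoc, reassoc_of% h, leftUnitor_naturality_assoc, e.inv_hom_id,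
          Category.comp_id]
      mul_smul := by
        have h := ModObj.mul_smul_self A M.X
        change μ[A] ▷ X ≫ A ◁ e.inv ≫ act M ≫ e.hom =
          (α_ A A X).hom ≫ A ◁ (A ◁ e.inv ≫ act M ≫ e.hom) ≫ A ◁ e.inv ≫ act M ≫ e.hom
        rw [← whisker_exchange_assoc, reassoc_of% h, ← MonoidalCategory.whiskerLeft_comp_assoc]
        simp }
  ⟨X⟩

/-- The transported module is isomorphic to the original one. -/
def transportIso (M : Mod C A) {X : C} (e : M.X ≅ X) : M ≅ transportMod M e :=
  haveI : IsIso (mkHom (M := M) (N := transportMod M e) e.hom (by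
    change act M ≫ e.hom = A ◁ e.hom ≫ A ◁ e.inv ≫ act M ≫ e.hom
    simp)).hom := inferInstanceAs (IsIso e.hom)
  mkIso (mkHom (M := M) (N := transportMod M e) e.hom _)

variable (A) in
/-- Systems of representatives exist. -/
theorem exists_isRepresentatives : ∃ L : Set (Mod C A), IsRepresentatives L := by
  -- Two independent choices are made: an object `q X` in each isomorphism class of `C`, and a
  -- module `r V` in each class of modules. Moving `r V` onto the chosen object makes isomorphic
  -- underlying objects equal.
  let q (X : C) : C := (Quotient.mk (isIsomorphicSetoid C) X).out
  have e (X : C) : X ≅ q X := (Quotient.mk_out (s := isIsomorphicSetoid C) X).some.symm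
  have hq {X Y : C} (h : Nonempty (X ≅ Y)) : q X = q Y :=
    congrArg Quotient.out (Quotient.sound (s := isIsomorphicSetoid C) h)
  let r (V : Mod C A) : Mod C A := (Quotient.mk (isIsomorphicSetoid (Mod C A)) V).out
  have er (V : Mod C A) : V ≅ r V :=
    (Quotient.mk_out (s := isIsomorphicSetoid (Mod C A)) V).some.symm
  have hr {V W : Mod C A} (h : Nonempty (V ≅ W)) : r V = r W :=
    congrArg Quotient.out (Quotient.sound (s := isIsomorphicSetoid (Mod C A)) h)
  let F (V : Mod C A) : Mod C A := transportMod (r V) (e (r V).X)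
  have eF (V : Mod C A) : V ≅ F V := er V ≪≫ transportIso (r V) (e (r V).X)
  have hF {V W : Mod C A} (h : Nonempty (V ≅ W)) : F V = F W :=
    congrArg (fun V : Mod C A => transportMod V (e V.X)) (hr h)
  refine ⟨{W | ∃ V : Mod C A, Simple V ∧ F V = W}, ?_, ?_, ?_, ?_⟩
  · rintro _ ⟨V, hV, rfl⟩
    exact Simple.of_iso (eF V).symm
  · exact fun V hV => ⟨F V, ⟨V, hV, rfl⟩, ⟨eF V⟩⟩
  · rintro _ ⟨V, hV, rfl⟩ _ ⟨W, hW, rfl⟩ ⟨i⟩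
    exact hF ⟨eF V ≪≫ i ≪≫ (eF W).symm⟩
  · rintro _ ⟨V, hV, rfl⟩ _ ⟨W, hW, rfl⟩ ⟨i⟩
    exact hq ⟨e (r V).X ≪≫ i ≪≫ (e (r W).X).symm⟩

end ExistsRepresentatives

/-! ### Schur's lemma for intertwiners -/

section SmulId
variable {C : Type u} [Category.{v} C] [Preadditive C] [Linear ℂ C] [MonoidalCategory C]
  [MonoidalPreadditive C] {A : C} [MonObj A]

lemma smul_id_injective (V : Mod C A) [Simple V] {a b : ℂ} (h : a • 𝟙 V.X = b • 𝟙 V.X) :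
    a = b := by
  have hV : 𝟙 V.X ≠ 0 := fun h => id_nonzero V (Mod.hom_ext _ _ h)
  exact smul_left_injective ℂ hV h

end SmulId

section Schur
variable {C : Type u} [Category.{v} C] [Abelian C] [Linear ℂ C] [MonoidalCategory C]
  [MonoidalPreadditive C] [MonoidalLinear ℂ C] [IsFusion C] {A : C} [MonObj A]

lemma exists_smul_of_simple {V W : Mod C A} [Simple V] (u w : V ≅ W) :
    ∃ c : ℂˣ, w.hom = (c : ℂ) • u.hom := by
  obtain ⟨c, hc⟩ := endomorphism_simple_eq_smul_id ℂ (w.hom ≫ u.inv)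
  have hw : w.hom = c • u.hom := by
    rw [← Category.id_comp u.hom, ← Linear.smul_comp, hc, Category.assoc, u.inv_hom_id,
      Category.comp_id]
  have hc0 : c ≠ 0 := by
    rintro rfl
    rw [zero_smul] at hw
    refine id_nonzero V ?_
    rw [← w.hom_inv_id, hw, zero_comp]
  exact ⟨Units.mk0 c hc0, hw⟩

lemma Intertwines.exists_smul {g : AutAlg A} {V W : Mod C A} [Simple V] {u w : V.X ≅ W.X}
    (hu : Intertwines g V W u.hom) (hw : Intertwines g V W w.hom) :
    ∃ c : ℂˣ, w.hom = (c : ℂ) • u.hom := by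
  have : IsIso hu.toHom.hom := inferInstanceAs (IsIso u.hom)
  have : IsIso hw.toHom.hom := inferInstanceAs (IsIso w.hom)
  obtain ⟨c, hc⟩ := exists_smul_of_simple (mkIso hu.toHom) (mkIso hw.toHom)
  exact ⟨c, congrArg Mod.Hom.hom hc⟩

end Schur

/-! ### Free modules, finiteness, and natural scalars -/

section Free
variable {C : Type u} [Category.{v} C] [MonoidalCategory C] (A : C) [MonObj A]

/-- The free module on an object. -/
def freeMod (X : C) : Mod C A :=
  letI : ModObj A (A ⊗ X) :=
    { smul := (α_ A A X).inv ≫ μ[A] ▷ X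
      one_smul := by
        change η[A] ▷ (A ⊗ X) ≫ (α_ A A X).inv ≫ μ[A] ▷ X = (λ_ _).hom
        rw [associator_inv_naturality_left_assoc, ← comp_whiskerRight, MonObj.one_mul]
        simp
      mul_smul := by
        change μ[A] ▷ (A ⊗ X) ≫ (α_ A A X).inv ≫ μ[A] ▷ X = (α_ A A (A ⊗ X)).hom ≫
          A ◁ ((α_ A A X).inv ≫ μ[A] ▷ X) ≫ (α_ A A X).inv ≫ μ[A] ▷ X
        rw [associator_inv_naturality_left_assoc, ← comp_whiskerRight, MonObj.mul_assoc]
        simp }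
  ⟨A ⊗ X⟩

/-- The module morphism out of a free module induced by a morphism of `C`. -/
def freeMod.desc {X : C} {M : Mod C A} (f : X ⟶ M.X) : freeMod A X ⟶ M :=
  mkHom (M := freeMod A X) (A ◁ f ≫ act M) (by
    have h := ModObj.mul_smul_self A M.X
    change ((α_ A A X).inv ≫ μ[A] ▷ X) ≫ A ◁ f ≫ act M = A ◁ (A ◁ f ≫ act M) ≫ act M
    rw [Category.assoc, ← whisker_exchange_assoc, h]
    simp)

lemma freeMod.unit_desc {X : C} {M : Mod C A} (f : X ⟶ M.X) :
    (λ_ X).inv ≫ η[A] ▷ X ≫ (freeMod.desc A f).hom = f := by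
  have h := ModObj.one_smul_self A M.X
  change (λ_ X).inv ≫ η[A] ▷ X ≫ A ◁ f ≫ act M = f
  rw [← whisker_exchange_assoc, h]
  simp

end Free

section Decomposition
variable {C : Type u} [Category.{v} C] [Abelian C] [MonoidalCategory C]
  [MonoidalPreadditive C] {A : C} [MonObj A] {L : Set (Mod C A)}

/-- Schur's lemma and the uniqueness of representatives: distinct members of `L` have no nonzero
morphisms between them. -/
lemma IsRepresentatives.eq_of_hom_ne_zero (hL : IsRepresentatives L) {V W : L}
    {f : V.1 ⟶ W.1} (hf : f ≠ 0) : V = W := by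
  have := hL.simple V.1 V.2
  have := hL.simple W.1 W.2
  have := isIso_of_hom_simple hf
  exact Subtype.ext (hL.eq_of_iso _ V.2 _ W.2 ⟨asIso f⟩)

lemma IsRepresentatives.exists_sum_eq_id (hL : IsRepresentatives L) {M : Mod C A}
    (hM : IsSemisimple M) : ∃ (J : Type) (_ : Fintype J) (V : J → L) (p : ∀ j, M ⟶ (V j).1)
      (i : ∀ j, (V j).1 ⟶ M), ∑ j, p j ≫ i j = 𝟙 M := by
  obtain ⟨J, _, V, p, i, hV, h⟩ := hM
  choose W hW e using fun j => hL.exists_iso (V j) (hV j)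
  exact ⟨J, inferInstance, fun j => ⟨W j, hW j⟩, fun j => p j ≫ (e j).some.hom,
    fun j => (e j).some.inv ≫ i j, by simpa using h⟩

end Decomposition

section Representatives
variable {C : Type u} [Category.{v} C] [Abelian C] [Linear ℂ C] [MonoidalCategory C]
  [MonoidalPreadditive C] [MonoidalLinear ℂ C] [IsFusion C] {A : C} [MonObj A]
  {L : Set (Mod C A)}

/-- There are finitely many simple modules up to isomorphism. -/
lemma IsRepresentatives.finite [ComonObj A] (hA : IsStronglySeparableFrobenius A)
    (hL : IsRepresentatives L) : Finite L := by
  obtain ⟨n, S, hS⟩ := IsFusion.finite_simple (C := C)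
  -- A simple module `W` receives a nonzero map in `C` from some simple object `S k`, hence a
  -- nonzero module map from the free module on `S k`. That map is nonzero on some constituent of
  -- the free module, which must be `W`; finitely many free modules thus account for all of `L`.
  choose J hJ V p i h using fun k => hL.exists_sum_eq_id (isSemisimple hA (freeMod A (S k)))
  let F : (Σ k, J k) → L := fun x => V x.1 x.2
  refine Finite.of_surjective F fun W => ?_
  have := hL.simple W.1 W.2
  have hW : 𝟙 W.1.X ≠ 0 := fun h => id_nonzero W.1 (Mod.hom_ext _ _ h)
  obtain ⟨m, T, hT, ⟨e⟩⟩ := IsFusion.semisimple W.1.X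
  obtain ⟨j, hj⟩ : ∃ j, Sigma.ι T j ≫ e.inv ≠ 0 := by
    by_contra! h
    have : e.inv = 0 := Sigma.hom_ext _ _ fun j => by rw [h j, comp_zero]
    exact hW (by rw [← e.hom_inv_id, this, comp_zero])
  obtain ⟨k, ⟨a⟩⟩ := hS (T j) (hT j)
  let f : S k ⟶ W.1.X := a.inv ≫ Sigma.ι T j ≫ e.inv
  have hf : f ≠ 0 := fun h => hj (by
    rw [← a.hom_inv_id_assoc (Sigma.ι T j ≫ e.inv)]
    exact (congrArg (a.hom ≫ ·) h).trans comp_zero)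
  have hd : freeMod.desc A f ≠ 0 := fun h => hf (by
    rw [← freeMod.unit_desc A f, h]
    exact (congrArg ((λ_ (S k)).inv ≫ ·) comp_zero).trans comp_zero)
  obtain ⟨x, hx⟩ : ∃ x, i k x ≫ freeMod.desc A f ≠ 0 := by
    by_contra! h'
    refine hd ?_
    rw [← Category.id_comp (freeMod.desc A f), ← h k, Preadditive.sum_comp]
    exact Finset.sum_eq_zero fun x _ => by rw [Category.assoc, h' x, comp_zero]
  exact ⟨⟨k, x⟩, hL.eq_of_hom_ne_zero hx⟩

/-- Natural endomorphisms of the underlying objects are determined by their values on a system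
of representatives. -/
lemma IsRepresentatives.natural_ext [ComonObj A] (hA : IsStronglySeparableFrobenius A)
    (hL : IsRepresentatives L) (φ ψ : ∀ M : Mod C A, M.X ⟶ M.X)
    (hφ : ∀ {M N : Mod C A} (f : M ⟶ N), φ M ≫ f.hom = f.hom ≫ φ N)
    (hψ : ∀ {M N : Mod C A} (f : M ⟶ N), ψ M ≫ f.hom = f.hom ≫ ψ N)
    (h : ∀ V : L, φ V.1 = ψ V.1) (M : Mod C A) : φ M = ψ M := by
  obtain ⟨J, _, V, p, i, hM⟩ := hL.exists_sum_eq_id (isSemisimple hA M)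
  have hM' : ∑ j, (p j).hom ≫ (i j).hom = 𝟙 M.X := by
    rw [← Mod.id_hom', ← hM, sum_hom]; rfl
  rw [← Category.id_comp (φ M), ← Category.id_comp (ψ M), ← hM', Preadditive.sum_comp,
    Preadditive.sum_comp]
  refine Finset.sum_congr rfl fun j _ => ?_
  rw [Category.assoc, Category.assoc, ← hφ, ← hψ, h]

/-- On a chosen decomposition of `M` the constituent `V` is scaled by `c V`. A map from `M` to a
representative `W` only sees constituents equal to `W`, so it is scaled by `c W`; this yields
naturality whatever decompositions were chosen. -/
lemma IsRepresentatives.exists_natural [ComonObj A] (hA : IsStronglySeparableFrobenius A)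
    (hL : IsRepresentatives L) (c : L → ℂ) : ∃ φ : ∀ M : Mod C A, M ⟶ M,
      (∀ {M N : Mod C A} (f : M ⟶ N), φ M ≫ f = f ≫ φ N) ∧ ∀ V : L, φ V.1 = c V • 𝟙 V.1 := by
  choose J hJ V p i hM using fun M : Mod C A => hL.exists_sum_eq_id (isSemisimple hA M)
  have key {M : Mod C A} {W : L} (f : M ⟶ W.1) (k : J M) :
      c (V M k) • i M k ≫ f = c W • i M k ≫ f := by
    by_cases h : i M k ≫ f = 0
    · rw [h, smul_zero, smul_zero]
    · exact congrArg (fun W => c W • i M k ≫ f) (hL.eq_of_hom_ne_zero h)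
  have hφ {M : Mod C A} {W : L} (f : M ⟶ W.1) :
      (∑ k, c (V M k) • p M k ≫ i M k) ≫ f = c W • f := by
    conv_rhs => rw [← Category.id_comp f, ← hM M]
    simp only [Preadditive.sum_comp, Finset.smul_sum, Linear.smul_comp, Category.assoc]
    refine Finset.sum_congr rfl fun k _ => ?_
    rw [← Linear.comp_smul, key, Linear.comp_smul]
  refine ⟨fun M => ∑ k, c (V M k) • p M k ≫ i M k, fun {M N} f => ?_, fun W => ?_⟩
  · have hf : ∑ k, (f ≫ p N k) ≫ i N k = f := by
      simp only [Category.assoc]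
      rw [← Preadditive.comp_sum, hM, Category.comp_id]
    rw [← hf, Preadditive.comp_sum, hf, Preadditive.comp_sum]
    refine Finset.sum_congr rfl fun k _ => ?_
    rw [← Category.assoc, hφ, Linear.smul_comp, Linear.comp_smul, Category.assoc]
  · rw [← hφ (𝟙 W.1), Category.comp_id]

end Representatives

/-! ### The representative of a twisted simple module -/

section Intertwine
variable {C : Type u} [Category.{v} C] [MonoidalCategory C] {A : C} [MonObj A]

lemma Intertwines.comp {g h : AutAlg A} {V W X : Mod C A} {u : V.X ⟶ W.X} {w : W.X ⟶ X.X}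
    (hu : Intertwines h V W u) (hw : Intertwines g W X w) : Intertwines (g * h) V X (u ≫ w) := by
  have key (σ τ : A ⟶ A) (hu : σ ▷ V.X ≫ act V ≫ u = A ◁ u ≫ act W)
      (hw : τ ▷ W.X ≫ act W ≫ w = A ◁ w ≫ act X) :
      (τ ≫ σ) ▷ V.X ≫ act V ≫ u ≫ w = A ◁ (u ≫ w) ≫ act X := by
    rw [comp_whiskerRight, Category.assoc, reassoc_of% hu, ← whisker_exchange_assoc, hw]
    simp
  exact (congrArg (· ▷ V.X ≫ act V ≫ u ≫ w) (inv_mul_hom g h)).trans (key _ _ hu hw)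

lemma intertwines_id (V : Mod C A) : Intertwines 1 V V (𝟙 V.X) := by
  unfold Intertwines
  rw [inv_one_hom]
  simp

/-- An invertible intertwiner, as an isomorphism of modules. -/
def Intertwines.toIso {g : AutAlg A} {V W : Mod C A} {u : V.X ≅ W.X}
    (h : Intertwines g V W u.hom) : (twist g).obj V ≅ W :=
  haveI : IsIso h.toHom.hom := inferInstanceAs (IsIso u.hom)
  mkIso h.toHom

lemma intertwines_of_iso {g : AutAlg A} {V W : Mod C A} (e : (twist g).obj V ≅ W) :
    Intertwines g V W e.hom.hom :=
  (Category.assoc _ _ _).symm.trans (act_hom e.hom)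

lemma withAct_injective (V : Mod C A) {ρ ρ' : ModObj A V.X} (h : withAct V ρ = withAct V ρ') :
    ρ = ρ' := by
  injection h

lemma exists_withAct_eq (V W : Mod C A) (h : V.X = W.X) : ∃ ρ : ModObj A V.X, withAct V ρ = W := by
  obtain ⟨X, hX⟩ := V
  obtain ⟨Y⟩ := W
  obtain rfl : X = Y := h
  exact ⟨_, rfl⟩

end Intertwine

section Representatives
variable {C : Type u} [Category.{v} C] [Abelian C] [Linear ℂ C] [MonoidalCategory C]
  [MonoidalPreadditive C] [MonoidalLinear ℂ C] [IsFusion C] {A : C} [MonObj A]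
  {L : Set (Mod C A)}

/-- The existence and uniqueness of the representative `g • V`. -/
theorem IsRepresentatives.existsUnique_rho (hL : IsRepresentatives L) (g : AutAlg A)
    (V : Mod C A) (hV : V ∈ L) : ∃! ρ' : ModObj A V.X, withAct V ρ' ∈ L ∧
      ∃ u : V.X ≅ V.X, Intertwines g V (withAct V ρ') u.hom ∧
        ∀ w : V.X ≅ V.X, Intertwines g V (withAct V ρ') w.hom →
          ∃ c : ℂˣ, w.hom = (c : ℂ) • u.hom := by
  have := hL.simple V hV
  obtain ⟨W, hW, ⟨e⟩⟩ := hL.exists_iso ((twist g).obj V) inferInstance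
  -- `T_g V` has the underlying object of `V`, so the representative `W` has an isomorphic one. The
  -- second condition on `L` makes it equal, and `W` is `V` with another action.
  obtain ⟨ρ, rfl⟩ := exists_withAct_eq V W (hL.eq_underlying V hV W hW
    ⟨homIso (M := (twist g).obj V) e⟩)
  refine ⟨ρ, ⟨hW, homIso (M := (twist g).obj V) (N := withAct V ρ) e, intertwines_of_iso e,
    fun w hw => Intertwines.exists_smul (V := V) (W := withAct V ρ)
      (u := homIso (M := (twist g).obj V) (N := withAct V ρ) e) (intertwines_of_iso e) hw⟩, ?_⟩
  rintro ρ' ⟨hW', u, hu, -⟩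
  exact withAct_injective V (hL.eq_of_iso _ hW' _ hW
    ⟨(Intertwines.toIso (W := withAct V ρ') hu).symm ≪≫ e⟩)

end Representatives

/-! ### The action on representatives and the cocycle -/

namespace Intertwiners

section Congr
variable {C : Type u} [Category.{v} C] [MonoidalCategory C]
  {A : C} [MonObj A] {L : Set (Mod C A)} (D : Intertwiners L)

/-- Representatives such as `(gh)·V` and `g·(h·V)` are equal only propositionally, while their
underlying objects coincide definitionally. The isomorphisms `u` at them are therefore compared
without `eqToHom`. -/
lemma u_congr (f : AutAlg A) (V : Mod C A) {ρ ρ' : ModObj A V.X} {m : withAct V ρ ∈ L}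
    {m' : withAct V ρ' ∈ L} (h : (⟨withAct V ρ, m⟩ : L) = ⟨withAct V ρ', m'⟩) :
    (D.u f ⟨withAct V ρ, m⟩).hom = (D.u f ⟨withAct V ρ', m'⟩).hom := by
  obtain rfl := withAct_injective V (congrArg Subtype.val h)
  rfl

/-- The module isomorphism `T_g V ≅ g • V` given by `u_g`. -/
def iso (g : AutAlg A) (V : L) : (twist g).obj V.1 ≅ (D.rep g V).1 :=
  (D.intertwines g V).toIso

end Congr

section Rep
variable {C : Type u} [Category.{v} C] [Preadditive C] [MonoidalCategory C]
  [MonoidalPreadditive C] {A : C} [MonObj A] {L : Set (Mod C A)} (D : Intertwiners L)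

lemma rep_one (hL : IsRepresentatives L) (V : L) : D.rep 1 V = V :=
  Subtype.ext (hL.eq_of_iso _ (D.rep 1 V).2 _ V.2 ⟨(D.iso 1 V).symm ≪≫ twistOneIso.app V.1⟩)

lemma rep_mul (hL : IsRepresentatives L) (g h : AutAlg A) (V : L) :
    D.rep (g * h) V = D.rep g (D.rep h V) :=
  Subtype.ext (hL.eq_of_iso _ (D.rep (g * h) V).2 _ (D.rep g (D.rep h V)).2
    ⟨(D.iso (g * h) V).symm ≪≫ (twistMulIso g h).app V.1 ≪≫ (twist g).mapIso (D.iso h V) ≪≫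
      D.iso g (D.rep h V)⟩)

variable [Linear ℂ C]

lemma u_smul_injective (hL : IsRepresentatives L) (g : AutAlg A) (V : L) {a b : ℂ}
    (h : a • (D.u g V).hom = b • (D.u g V).hom) : a = b := by
  have := hL.simple V.1 V.2
  refine smul_id_injective V.1 ?_
  rw [← (D.u g V).hom_inv_id, ← Linear.smul_comp, h, Linear.smul_comp]

/-- The scalars `β_V(g, h)` relate `u_g u_h` and `u_{gh}`. -/
def IsMultiplier (β : L → AutAlg A → AutAlg A → ℂˣ) : Prop :=
  ∀ (g h : AutAlg A) (V : L), (D.u h V).hom ≫ (D.u g (D.rep h V)).hom =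
    (β V g h : ℂ) • (D.u (g * h) V).hom

variable {D} {β : L → AutAlg A → AutAlg A → ℂˣ}

/-- The composite `u_f u_g u_h` is a multiple of `u_{fgh}` in two ways, one for each bracketing. The
coefficients agree because a nonzero morphism can be cancelled. -/
lemma IsMultiplier.cocycle (hβ : D.IsMultiplier β) (hL : IsRepresentatives L) (f g h : AutAlg A) (V : L) :
    β (D.rep h V) f g * β V (f * g) h = β V f (g * h) * β V g h := by
  have e₁ := congrArg ((D.u h V).hom ≫ ·) (hβ f g (D.rep h V))
  have e₂ := congrArg (· ≫ (D.u f (D.rep (g * h) V)).hom) (hβ g h V)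
  have e₃ : (D.u f (D.rep g (D.rep h V))).hom = (D.u f (D.rep (g * h) V)).hom :=
    D.u_congr f V.1 (D.rep_mul hL g h V).symm
  beta_reduce at e₁ e₂
  rw [Linear.comp_smul, hβ (f * g) h V, e₃] at e₁
  rw [Linear.smul_comp, hβ f (g * h) V, Category.assoc] at e₂
  refine Units.ext (D.u_smul_injective hL (f * (g * h)) V ?_)
  have e₄ := e₁.symm.trans e₂
  rw [smul_smul, smul_smul, _root_.mul_assoc f g h] at e₄
  rw [Units.val_mul, Units.val_mul, e₄, mul_comm]

/-- No normalisation `u_1 = 1` is imposed. The values of `β` at the identity are exactly the scalars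
of `u_1`, so a unit constraint given by `u_1` cancels them. -/
lemma IsMultiplier.β_one_left (hβ : D.IsMultiplier β) (hL : IsRepresentatives L)
    (g : AutAlg A) (V : L) {c : ℂ}
    (hc : (D.u 1 (D.rep g V)).hom = c • 𝟙 V.1.X) : (β V 1 g : ℂ) = c := by
  refine D.u_smul_injective hL g V ?_
  have h := hβ 1 g V
  rw [hc, _root_.one_mul] at h
  rw [← h, Linear.comp_smul, Category.comp_id]

lemma IsMultiplier.β_one_right (hβ : D.IsMultiplier β) (hL : IsRepresentatives L)
    (g : AutAlg A) (V : L) {c : ℂ}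
    (hc : (D.u 1 V).hom = c • 𝟙 V.1.X) : (β V g 1 : ℂ) = c := by
  refine D.u_smul_injective hL g V ?_
  have h := hβ g 1 V
  have e : (D.u g (D.rep 1 V)).hom = (D.u g V).hom := D.u_congr g V.1 (D.rep_one hL V)
  rw [hc, _root_.mul_one, e] at h
  rw [← h, Linear.smul_comp, Category.id_comp]

end Rep

variable {C : Type u} [Category.{v} C] [Abelian C] [Linear ℂ C] [MonoidalCategory C]
  [MonoidalPreadditive C] [MonoidalLinear ℂ C] [IsFusion C] {A : C} [MonObj A]
  {L : Set (Mod C A)} (D : Intertwiners L)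

/-- Both sides intertwine the action twisted by `gh` with that of the same representative, so
Schur's lemma applies. -/
lemma exists_u_comp_u (hL : IsRepresentatives L) (g h : AutAlg A) (V : L) :
    ∃ c : ℂˣ, (D.u h V).hom ≫ (D.u g (D.rep h V)).hom = (c : ℂ) • (D.u (g * h) V).hom := by
  have := hL.simple V.1 V.2
  have e : D.rho (g * h) V = D.rho g (D.rep h V) :=
    withAct_injective V.1 (congrArg Subtype.val (D.rep_mul hL g h V))
  have h₁ : Intertwines (g * h) V.1 (withAct V.1 (D.rho g (D.rep h V)))
      ((D.u h V ≪≫ D.u g (D.rep h V)).hom : V.1.X ⟶ V.1.X) :=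
    (D.intertwines h V).comp (D.intertwines g (D.rep h V))
  have h₂ := D.intertwines (g * h) V
  rw [e] at h₂
  exact Intertwines.exists_smul (W := withAct V.1 (D.rho g (D.rep h V)))
    (u := D.u (g * h) V) (w := D.u h V ≪≫ D.u g (D.rep h V)) h₂ h₁

lemma exists_u_one (hL : IsRepresentatives L) (V : L) :
    ∃ c : ℂˣ, (D.u 1 V).hom = (c : ℂ) • 𝟙 V.1.X := by
  have := hL.simple V.1 V.2
  have e : D.rho 1 V = V.1.mod :=
    withAct_injective V.1 (congrArg Subtype.val (D.rep_one hL V))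
  have h₂ := D.intertwines 1 V
  rw [e] at h₂
  exact Intertwines.exists_smul (W := withAct V.1 V.1.mod) (u := Iso.refl V.1.X) (w := D.u 1 V)
    (intertwines_id V.1) h₂

end Intertwiners

/-! ### The action with composition constraint `β⁻¹` -/

section NatScalar
variable {C : Type u} [Category.{v} C] [Abelian C] [Linear ℂ C] [MonoidalCategory C]
  [MonoidalPreadditive C] [MonoidalLinear ℂ C] [IsFusion C] {A : C} [MonObj A] [ComonObj A]
  {L : Set (Mod C A)}

lemma IsRepresentatives.exists_natIso (hA : IsStronglySeparableFrobenius A)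
    (hL : IsRepresentatives L) (c : L → ℂˣ) : ∃ θ : 𝟭 (Mod C A) ≅ 𝟭 (Mod C A),
      ∀ V : L, (θ.hom.app V.1).hom = (c V : ℂ) • 𝟙 V.1.X := by
  obtain ⟨φ, hφ, hc⟩ := hL.exists_natural hA (fun V => (c V : ℂ))
  obtain ⟨ψ, hψ, hd⟩ := hL.exists_natural hA (fun V => ((c V)⁻¹ : ℂ))
  have h₁ (M : Mod C A) : φ M ≫ ψ M = 𝟙 M := Mod.hom_ext _ _ <|
    hL.natural_ext hA (fun M => (φ M ≫ ψ M).hom) (fun M => (𝟙 M : M ⟶ M).hom)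
      (fun f => congrArg Mod.Hom.hom (by rw [Category.assoc, hψ, ← Category.assoc, hφ,
        Category.assoc] : (φ _ ≫ ψ _) ≫ f = f ≫ φ _ ≫ ψ _))
      (fun f => congrArg Mod.Hom.hom ((Category.id_comp f).trans (Category.comp_id f).symm))
      (fun V => congrArg Mod.Hom.hom (by
        rw [hc, hd, Linear.smul_comp, Category.id_comp, smul_smul, mul_inv_cancel₀ (c V).ne_zero,
          one_smul])) M
  have h₂ (M : Mod C A) : ψ M ≫ φ M = 𝟙 M := by rw [hψ, h₁]
  exact ⟨NatIso.ofComponents (fun M => ⟨φ M, ψ M, h₁ M, h₂ M⟩) (fun f => (hφ f).symm),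
    fun V => congrArg Mod.Hom.hom (hc V)⟩

/-- The natural automorphism of the identity functor acting on the representative `V` by the
scalar `c V`. -/
def natScalar (hA : IsStronglySeparableFrobenius A) (hL : IsRepresentatives L) (c : L → ℂˣ) :
    𝟭 (Mod C A) ≅ 𝟭 (Mod C A) :=
  (hL.exists_natIso hA c).choose

/-- The underlying morphism of a component of `natScalar`. -/
def natScalarHom (hA : IsStronglySeparableFrobenius A) (hL : IsRepresentatives L) (c : L → ℂˣ)
    (M : Mod C A) : M.X ⟶ M.X :=
  ((natScalar hA hL c).hom.app M).hom

variable (hA : IsStronglySeparableFrobenius A) (hL : IsRepresentatives L)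

lemma natScalarHom_apply (c : L → ℂˣ) (V : L) :
    natScalarHom hA hL c V.1 = (c V : ℂ) • 𝟙 V.1.X :=
  (hL.exists_natIso hA c).choose_spec V

lemma natScalarHom_natural (c : L → ℂˣ) {M N : Mod C A} (f : M ⟶ N) :
    natScalarHom hA hL c M ≫ f.hom = f.hom ≫ natScalarHom hA hL c N :=
  congrArg Mod.Hom.hom ((natScalar hA hL c).hom.naturality f).symm

lemma natScalarHom_comp (c d : L → ℂˣ) (M : Mod C A) :
    natScalarHom hA hL c M ≫ natScalarHom hA hL d M = natScalarHom hA hL (c * d) M :=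
  hL.natural_ext hA (fun M => natScalarHom hA hL c M ≫ natScalarHom hA hL d M)
    (natScalarHom hA hL (c * d))
    (fun f => by rw [Category.assoc, natScalarHom_natural, ← Category.assoc, natScalarHom_natural,
      Category.assoc])
    (natScalarHom_natural hA hL (c * d))
    (fun V => by
      rw [natScalarHom_apply, natScalarHom_apply, natScalarHom_apply, Linear.smul_comp,
        Category.id_comp, smul_smul, Pi.mul_apply, Units.val_mul]) M

lemma natScalarHom_one (M : Mod C A) : natScalarHom hA hL 1 M = 𝟙 M.X :=
  hL.natural_ext hA (natScalarHom hA hL 1) (fun M => 𝟙 M.X) (natScalarHom_natural hA hL 1)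
    (fun f => by rw [Category.id_comp, Category.comp_id])
    (fun V => by rw [natScalarHom_apply, Pi.one_apply, Units.val_one, one_smul]) M

/-- Naturality along `u_h : T_h V ⟶ h·V` shows that the scalar at `T_h V` is `c (h·V)`; the general
case follows since natural families are determined on `L`. This is the origin of `h·V` in the
cocycle identity. -/
lemma natScalarHom_twist (D : Intertwiners L) (c : L → ℂˣ) (h : AutAlg A) (M : Mod C A) :
    natScalarHom hA hL c ((twist h).obj M) = natScalarHom hA hL (fun V => c (D.rep h V)) M :=
  hL.natural_ext hA (fun M => natScalarHom hA hL c ((twist h).obj M))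
    (natScalarHom hA hL fun V => c (D.rep h V))
    (fun f => natScalarHom_natural hA hL c ((twist h).map f))
    (natScalarHom_natural hA hL _)
    (fun V => by
      have e₁ : natScalarHom hA hL c ((twist h).obj V.1) ≫ (D.u h V).hom =
          (D.u h V).hom ≫ natScalarHom hA hL c (D.rep h V).1 :=
        natScalarHom_natural hA hL c (D.hom h V)
      have e₂ : natScalarHom hA hL c (D.rep h V).1 = (c (D.rep h V) : ℂ) • 𝟙 V.1.X :=
        natScalarHom_apply hA hL c (D.rep h V)
      have e₃ (a : ℂ) : (D.u h V).hom ≫ (a • 𝟙 V.1.X) = (a • 𝟙 V.1.X) ≫ (D.u h V).hom := by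
        rw [Linear.comp_smul, Linear.smul_comp, Category.comp_id, Category.id_comp]
      rw [natScalarHom_apply]
      exact (cancel_mono (D.u h V).hom).1
        (e₁.trans ((congrArg ((D.u h V).hom ≫ ·) e₂).trans (e₃ _)))) M

variable {D : Intertwiners L} {β : L → AutAlg A → AutAlg A → ℂˣ} {c : L → ℂˣ}

/-- The action of `Aut(A)` on the category of modules with composition constraint `β⁻¹`. -/
def multiplierAction (hβ : D.IsMultiplier β)
    (hc : ∀ V : L, (D.u 1 V).hom = (c V : ℂ) • 𝟙 V.1.X) :
    GroupAction (fun g : AutAlg A => twist g) where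
  mulIso g h := Functor.isoWhiskerRight (natScalar hA hL fun V => (β V g h)⁻¹) (twist (g * h)) ≪≫
    twistMulIso g h
  oneIso := Functor.isoWhiskerRight (natScalar hA hL c) (twist 1) ≪≫ twistOneIso
  assoc f g h X := Mod.hom_ext _ _ (by
    have key {Y : C} {a₁ a₂ b₁ b₂ : Y ⟶ Y} (e : a₁ ≫ a₂ = b₁ ≫ b₂) :
        (a₁ ≫ 𝟙 Y) ≫ a₂ ≫ 𝟙 Y = 𝟙 Y ≫ (b₁ ≫ 𝟙 Y) ≫ b₂ ≫ 𝟙 Y := by simpa using e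
    -- The strict constraints are identities of `C`, so only the scalar factors remain. Compared on
    -- `L`, they give the inverse of the cocycle identity.
    have e : natScalarHom hA hL (fun V => (β V (f * g) h)⁻¹) X ≫
        natScalarHom hA hL (fun V => (β V f g)⁻¹) ((twist h).obj X) =
        natScalarHom hA hL (fun V => (β V f (g * h))⁻¹) X ≫
        natScalarHom hA hL (fun V => (β V g h)⁻¹) X := by
      refine (congrArg (natScalarHom hA hL _ X ≫ ·) (natScalarHom_twist hA hL D _ h X)).trans ?_
      refine (natScalarHom_comp hA hL _ _ X).trans (Eq.trans ?_ (natScalarHom_comp hA hL _ _ X).symm)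
      refine congrArg (natScalarHom hA hL · X) (funext fun V => ?_)
      simp only [Pi.mul_apply]
      rw [← mul_inv, ← mul_inv, mul_comm (β V (f * g) h), hβ.cocycle hL]
    refine (key e).trans ?_
    exact congrArg (· ≫ _) (Eq.symm ((eqToHom_hom _).trans rfl)))
  unit_left g X := Mod.hom_ext _ _ (by
    have key {Y : C} {a₁ a₂ : Y ⟶ Y} (e : a₁ ≫ a₂ = 𝟙 Y) :
        (a₁ ≫ 𝟙 Y) ≫ a₂ ≫ 𝟙 Y = 𝟙 Y := by simpa using e
    have e : natScalarHom hA hL (fun V => (β V 1 g)⁻¹) X ≫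
        natScalarHom hA hL c ((twist g).obj X) = 𝟙 X.X := by
      refine (congrArg (natScalarHom hA hL _ X ≫ ·) (natScalarHom_twist hA hL D _ g X)).trans ?_
      refine (natScalarHom_comp hA hL _ _ X).trans (Eq.trans ?_ (natScalarHom_one hA hL X))
      refine congrArg (natScalarHom hA hL · X) (funext fun V => ?_)
      have := Units.ext (hβ.β_one_left hL g V (hc (D.rep g V)))
      simp only [Pi.mul_apply, Pi.one_apply]
      rw [this, inv_mul_cancel]
    exact (key e).trans (Eq.symm ((eqToHom_hom _).trans rfl)))
  unit_right g X := Mod.hom_ext _ _ (by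
    have key {Y : C} {a₁ a₂ : Y ⟶ Y} (e : a₁ ≫ a₂ = 𝟙 Y) :
        (a₁ ≫ 𝟙 Y) ≫ a₂ ≫ 𝟙 Y = 𝟙 Y := by simpa using e
    have e : natScalarHom hA hL (fun V => (β V g 1)⁻¹) X ≫ natScalarHom hA hL c X = 𝟙 X.X := by
      refine (natScalarHom_comp hA hL _ _ X).trans (Eq.trans ?_ (natScalarHom_one hA hL X))
      refine congrArg (natScalarHom hA hL · X) (funext fun V => ?_)
      have := Units.ext (hβ.β_one_right hL g V (hc V))
      simp only [Pi.mul_apply, Pi.one_apply]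
      rw [this, inv_mul_cancel]
    exact (key e).trans (Eq.symm ((eqToHom_hom _).trans rfl)))

lemma multiplierAction_mulIso_hom (hβ : D.IsMultiplier β)
    (hc : ∀ V : L, (D.u 1 V).hom = (c V : ℂ) • 𝟙 V.1.X) (g h : AutAlg A) (M : Mod C A) :
    (((multiplierAction hA hL hβ hc).mulIso g h).hom.app M).hom =
      natScalarHom hA hL (fun V => (β V g h)⁻¹) M :=
  Category.comp_id _

lemma multiplierAction_oneIso_hom (hβ : D.IsMultiplier β)
    (hc : ∀ V : L, (D.u 1 V).hom = (c V : ℂ) • 𝟙 V.1.X) (M : Mod C A) :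
    ((multiplierAction hA hL hβ hc).oneIso.hom.app M).hom = natScalarHom hA hL c M :=
  Category.comp_id _

end NatScalar

/-! ### Direct sums of modules -/

section Biproduct
variable {C : Type u} [Category.{v} C] [Preadditive C] [MonoidalCategory C]
  [MonoidalPreadditive C] {A : C} [MonObj A]

/-- The direct sum of modules: the biproduct in `C` with the componentwise action. -/
def biproductMod {J : Type w} (M : J → Mod C A) [HasBiproduct fun j => (M j).X] : Mod C A :=
  letI : ModObj A (⨁ fun j => (M j).X) :=
    { smul := biproduct.lift fun j => A ◁ biproduct.π (fun j => (M j).X) j ≫ act (M j)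
      one_smul := biproduct.hom_ext _ _ fun j => by
        have h := ModObj.one_smul_self A (M j).X
        change (η[A] ▷ _ ≫ biproduct.lift _) ≫ biproduct.π _ j = (λ_ _).hom ≫ biproduct.π _ j
        rw [Category.assoc, biproduct.lift_π, ← whisker_exchange_assoc, h, leftUnitor_naturality]
      mul_smul := biproduct.hom_ext _ _ fun j => by
        have h := ModObj.mul_smul_self A (M j).X
        change (μ[A] ▷ _ ≫ biproduct.lift _) ≫ biproduct.π _ j =
          ((α_ _ _ _).hom ≫ A ◁ biproduct.lift _ ≫ biproduct.lift _) ≫ biproduct.π _ j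
        simp only [Category.assoc, biproduct.lift_π]
        rw [← whisker_exchange_assoc, h, ← MonoidalCategory.whiskerLeft_comp_assoc,
          biproduct.lift_π]
        simp }
  ⟨⨁ fun j => (M j).X⟩

variable {J : Type w} (M : J → Mod C A) [HasBiproduct fun j => (M j).X]

/-- The projections of the direct sum. -/
def biproductMod.proj (j : J) : biproductMod M ⟶ M j :=
  mkHom (biproduct.π (fun j => (M j).X) j) (biproduct.lift_π _ _)

/-- The inclusions of the direct sum. -/
def biproductMod.incl (j : J) : M j ⟶ biproductMod M :=
  mkHom (biproduct.ι (fun j => (M j).X) j) (biproduct.hom_ext _ _ fun k => by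
    change (act (M j) ≫ biproduct.ι (fun j => (M j).X) j) ≫ biproduct.π (fun j => (M j).X) k =
      (A ◁ biproduct.ι (fun j => (M j).X) j ≫
        biproduct.lift fun j => A ◁ biproduct.π (fun j => (M j).X) j ≫ act (M j)) ≫ biproduct.π _ k
    rw [Category.assoc, Category.assoc, biproduct.lift_π,
      ← MonoidalCategory.whiskerLeft_comp_assoc]
    by_cases h : j = k
    · subst h
      simp
    · simp [biproduct.ι_π_ne _ h])

lemma biproductMod.incl_sum [Fintype J] {N : Mod C A} (f : ∀ j, M j ⟶ N) (j : J) :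
    biproductMod.incl M j ≫ ∑ k, biproductMod.proj M k ≫ f k = f j := by
  have h (k : J) (hk : k ≠ j) : biproductMod.incl M j ≫ biproductMod.proj M k = 0 :=
    Mod.hom_ext _ _ (biproduct.ι_π_ne _ hk.symm)
  have h' : biproductMod.incl M j ≫ biproductMod.proj M j = 𝟙 (M j) :=
    Mod.hom_ext _ _ (biproduct.ι_π_self _ j)
  rw [Preadditive.comp_sum, Finset.sum_eq_single j, reassoc_of% h']
  · intro k _ hk
    rw [reassoc_of% (h k hk), zero_comp]
  · exact fun h => absurd (Finset.mem_univ j) h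

variable {M} in
lemma biproductMod.hom_ext {Y : C} {f g : (biproductMod M).X ⟶ Y}
    (h : ∀ j, (biproductMod.incl M j).hom ≫ f = (biproductMod.incl M j).hom ≫ g) : f = g :=
  biproduct.hom_ext' _ _ h

/-- The direct sum of modules is a coproduct. -/
def biproductMod.isColimit [Fintype J] :
    IsColimit (Cofan.mk (biproductMod M) (biproductMod.incl M)) :=
  Cofan.IsColimit.mk _ (fun s => ∑ j, biproductMod.proj M j ≫ s.inj j)
    (fun s j => biproductMod.incl_sum M s.inj j)
    (fun s _ hm => Mod.hom_ext _ _ (biproductMod.hom_ext fun j =>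
      congrArg Mod.Hom.hom ((hm j).trans (biproductMod.incl_sum M s.inj j).symm)))

end Biproduct

/-! ### The equivariant structure on a stable direct sum -/

section Equivariant
variable {C : Type u} [Category.{v} C] [Abelian C] [MonoidalCategory C]
  [MonoidalPreadditive C] {A : C} [MonObj A] {L : Set (Mod C A)} (D : Intertwiners L)
  {S : Set L} (hS : ∀ g : AutAlg A, ∀ V ∈ S, D.rep g V ∈ S)
  [HasBiproduct fun V : S => V.1.1.X]

/-- The direct sum of the modules in a set of representatives. -/
abbrev sumRep (S : Set L) [HasBiproduct fun V : S => V.1.1.X] : Mod C A :=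
  biproductMod fun V : S => V.1.1

/-- The inclusion of a summand, as a morphism of `C`. -/
abbrev sumRep.incl {S : Set L} [HasBiproduct fun V : S => V.1.1.X] (V : L) (hV : V ∈ S) :
    V.1.X ⟶ (sumRep S).X :=
  (biproductMod.incl (fun V : S => V.1.1) ⟨V, hV⟩).hom

lemma sumRep.incl_congr (V : Mod C A) {ρ ρ' : ModObj A V.X} {m : withAct V ρ ∈ L}
    {m' : withAct V ρ' ∈ L} {s : (⟨withAct V ρ, m⟩ : L) ∈ S} {s' : (⟨withAct V ρ', m'⟩ : L) ∈ S}
    (h : (⟨withAct V ρ, m⟩ : L) = ⟨withAct V ρ', m'⟩) :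
    sumRep.incl ⟨withAct V ρ, m⟩ s = sumRep.incl ⟨withAct V ρ', m'⟩ s' := by
  obtain rfl := withAct_injective V (congrArg Subtype.val h)
  rfl

variable [Fintype S]

/-- The sum of the isomorphisms `u_g`. -/
def sumHom (g : AutAlg A) : (twist g).obj (sumRep S) ⟶ sumRep S :=
  ∑ V : S, (twist g).map (biproductMod.proj (fun V : S => V.1.1) V) ≫ D.hom g V.1 ≫
    biproductMod.incl (fun V : S => V.1.1) ⟨D.rep g V.1, hS g V.1 V.2⟩

lemma incl_sumHom (g : AutAlg A) (V : S) :
    (biproductMod.incl (fun V : S => V.1.1) V).hom ≫ (sumHom D hS g).hom =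
      (D.u g V.1).hom ≫ sumRep.incl (D.rep g V.1) (hS g V.1 V.2) := by
  have h (W : S) (hW : W ≠ V) : (biproductMod.incl (fun V : S => V.1.1) V).hom ≫
      (biproductMod.proj (fun V : S => V.1.1) W).hom = 0 :=
    biproduct.ι_π_ne _ hW.symm
  have h' : (biproductMod.incl (fun V : S => V.1.1) V).hom ≫
      (biproductMod.proj (fun V : S => V.1.1) V).hom = 𝟙 V.1.1.X :=
    biproduct.ι_π_self _ V
  have e : (sumHom D hS g).hom = ∑ V : S, (biproductMod.proj (fun V : S => V.1.1) V).hom ≫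
      (D.u g V.1).hom ≫ sumRep.incl (D.rep g V.1) (hS g V.1 V.2) := sum_hom _ _
  refine (congrArg ((biproductMod.incl (fun V : S => V.1.1) V).hom ≫ ·) e).trans ?_
  refine (Preadditive.comp_sum _ _ _).trans ?_
  rw [Finset.sum_eq_single V, reassoc_of% h']
  · intro W _ hW
    rw [reassoc_of% (h W hW), zero_comp]
  · exact fun h => absurd (Finset.mem_univ V) h

lemma map_incl_comp_sumHom (g : AutAlg A) (V : S) :
    (twist g).map (biproductMod.incl (fun V : S => V.1.1) V) ≫ sumHom D hS g =
      D.hom g V.1 ≫ biproductMod.incl (fun V : S => V.1.1) ⟨D.rep g V.1, hS g V.1 V.2⟩ :=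
  Mod.hom_ext _ _ (incl_sumHom D hS g V)

variable (b : GroupAction fun g : AutAlg A => twist g)

/-- Morphisms out of the direct sum are compared on summands. Naturality of the constraint moves it
onto `V`, where the identity is the hypothesis `hb`. -/
lemma sumHom_square (hL : IsRepresentatives L)
    (hb : ∀ (g h : AutAlg A) (V : L), ((b.mulIso g h).hom.app V.1).hom ≫ (D.u h V).hom ≫
      (D.u g (D.rep h V)).hom = (D.u (g * h) V).hom) (g h : AutAlg A) :
    (b.mulIso g h).hom.app (sumRep S) ≫ (twist g).map (sumHom D hS h) ≫ sumHom D hS g =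
      sumHom D hS (g * h) :=
  Mod.hom_ext _ _ (biproductMod.hom_ext fun V => by
    have e₁ : (biproductMod.incl (fun V : S => V.1.1) V).hom ≫
        ((b.mulIso g h).hom.app (sumRep S)).hom =
        ((b.mulIso g h).hom.app V.1.1).hom ≫ (biproductMod.incl (fun V : S => V.1.1) V).hom :=
      congrArg Mod.Hom.hom
        ((b.mulIso g h).hom.naturality (biproductMod.incl (fun V : S => V.1.1) V))
    have e₂ := incl_sumHom D hS h V
    have e₃ := incl_sumHom D hS g ⟨D.rep h V.1, hS h V.1 V.2⟩
    have e₄ : sumRep.incl (D.rep g (D.rep h V.1)) (hS g _ (hS h V.1 V.2)) =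
      sumRep.incl (D.rep (g * h) V.1) (hS (g * h) V.1 V.2) :=
      sumRep.incl_congr V.1.1 (D.rep_mul hL g h V.1).symm
    have key {X₁ X₂ : C} {i i₂ i' i'' : X₁ ⟶ X₂} {m : X₂ ⟶ X₂} {n a a' a'' : X₁ ⟶ X₁}
        {s t r : X₂ ⟶ X₂} (e₁ : i ≫ m = n ≫ i) (e₂ : i ≫ s = a ≫ i') (e₃ : i' ≫ t = a' ≫ i₂)
        (e₅ : n ≫ a ≫ a' = a'') (e₄ : i₂ = i'') (e₆ : i ≫ r = a'' ≫ i'') :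
        i ≫ m ≫ s ≫ t = i ≫ r := by
      rw [reassoc_of% e₁, reassoc_of% e₂, e₃, e₆, ← e₅, e₄]
      simp
    exact key e₁ e₂ e₃ (hb g h V.1) e₄ (incl_sumHom D hS (g * h) V))

lemma sumHom_one (hL : IsRepresentatives L) (hb : ∀ V : L, (b.oneIso.hom.app V.1).hom = (D.u 1 V).hom) :
    sumHom D hS 1 = b.oneIso.hom.app (sumRep S) :=
  Mod.hom_ext _ _ (biproductMod.hom_ext fun V => by
    have e₁ : (biproductMod.incl (fun V : S => V.1.1) V).hom ≫ (b.oneIso.hom.app (sumRep S)).hom =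
        (b.oneIso.hom.app V.1.1).hom ≫ (biproductMod.incl (fun V : S => V.1.1) V).hom :=
      congrArg Mod.Hom.hom
        (b.oneIso.hom.naturality (biproductMod.incl (fun V : S => V.1.1) V))
    have e₄ : sumRep.incl (D.rep 1 V.1) (hS 1 V.1 V.2) = sumRep.incl V.1 V.2 :=
      sumRep.incl_congr V.1.1 (D.rep_one hL V.1)
    refine (incl_sumHom D hS 1 V).trans (Eq.trans ?_ e₁.symm)
    rw [hb]
    exact congrArg ((D.u 1 V.1).hom ≫ ·) e₄)

/-- At `g = 1` the morphism is the unit constraint, hence invertible. The squares for `(g, g⁻¹)` and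
`(g⁻¹, g)` then make it epi and mono for general `g`, and `C` is abelian. -/
lemma isIso_sumHom (hL : IsRepresentatives L)
    (hb : ∀ (g h : AutAlg A) (V : L), ((b.mulIso g h).hom.app V.1).hom ≫ (D.u h V).hom ≫
      (D.u g (D.rep h V)).hom = (D.u (g * h) V).hom)
    (hb₁ : ∀ V : L, (b.oneIso.hom.app V.1).hom = (D.u 1 V).hom) (g : AutAlg A) :
    IsIso (sumHom D hS g) := by
  have h₁ : IsIso (sumHom D hS 1).hom := by
    rw [sumHom_one D hS b hL hb₁]
    infer_instance
  have h (g h : AutAlg A) (e : g * h = 1) : Epi (sumHom D hS g).hom ∧ Mono (sumHom D hS h).hom := by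
    have e₁ : ((b.mulIso g h).hom.app (sumRep S)).hom ≫ (sumHom D hS h).hom ≫
        (sumHom D hS g).hom = (sumHom D hS (g * h)).hom :=
      congrArg Mod.Hom.hom (sumHom_square D hS b hL hb g h)
    have h₂ : IsIso (sumHom D hS (g * h)).hom := by rw [e]; exact h₁
    have key {X : C} {x y z w : X ⟶ X} [IsIso x] (hw : IsIso w) (e : x ≫ y ≫ z = w) :
        Epi z ∧ Mono y := by
      have : Epi ((x ≫ y) ≫ z) := by rw [Category.assoc, e]; infer_instance
      have e' : y ≫ z = inv x ≫ w := by rw [← e, IsIso.inv_hom_id_assoc]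
      have : Mono (y ≫ z) := by rw [e']; infer_instance
      exact ⟨epi_of_epi (x ≫ y) z, mono_of_mono y z⟩
    have : IsIso ((b.mulIso g h).hom.app (sumRep S)).hom := inferInstance
    exact @key (sumRep S).X _ _ _ _ this h₂ e₁
  have := (h g g⁻¹ (mul_inv_cancel g)).1
  have := (h g⁻¹ g (inv_mul_cancel g)).2
  rw [isIso_iff_hom]
  exact isIso_of_mono_of_epi _

end Equivariant

/-! ### Transport of actions along natural isomorphisms -/

section EqToHom
variable {G : Type w} {D : Type u} [Category.{v} D]

lemma eqToHom_app_natural {T T' : G → D ⥤ D} (e : ∀ g, T g ≅ T' g) {g h : G} (p : g = h) (X : D) :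
    (e g).hom.app X ≫ eqToHom (by rw [p]) = eqToHom (by rw [p]) ≫ (e h).hom.app X := by
  subst p
  simp

end EqToHom

section Transport
variable {G : Type w} [Group G] {D : Type u} [Category.{v} D]

/-- The transport of a group action along natural isomorphisms. -/
def GroupAction.transport {T T' : G → D ⥤ D} (a : GroupAction T) (e : ∀ g, T g ≅ T' g) :
    GroupAction T' where
  mulIso g h := (e (g * h)).symm ≪≫ a.mulIso g h ≪≫ Functor.isoWhiskerRight (e h) (T g) ≪≫
    Functor.isoWhiskerLeft (T' h) (e g)
  oneIso := (e 1).symm ≪≫ a.oneIso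
  assoc f g h X := by
    rw [← cancel_epi ((e (f * g * h)).hom.app X)]
    have h₁ := a.assoc f g h X
    have h₂ := eqToHom_app_natural e (_root_.mul_assoc f g h) X
    simp only [Iso.trans_hom, Iso.symm_hom, NatTrans.comp_app, Functor.isoWhiskerRight_hom,
      Functor.isoWhiskerLeft_hom, Functor.whiskerRight_app, Functor.whiskerLeft_app,
      Category.assoc, Iso.hom_inv_id_app_assoc, NatTrans.naturality_assoc, reassoc_of% h₁,
      reassoc_of% h₂, Functor.map_comp, NatTrans.naturality, Functor.comp_map]
    have h₃ := congrArg (T' f).map ((e g).hom.naturality ((e h).hom.app X))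
    simp only [Functor.map_comp] at h₃
    simp [h₃]
  unit_left g X := by
    rw [← cancel_epi ((e (1 * g)).hom.app X)]
    have h₁ := a.unit_left g X
    have h₂ := eqToHom_app_natural e (_root_.one_mul g) X
    refine Eq.trans ?_ h₂.symm
    simp [reassoc_of% h₁]
  unit_right g X := by
    rw [← cancel_epi ((e (g * 1)).hom.app X)]
    have h₁ := a.unit_right g X
    have h₂ := eqToHom_app_natural e (_root_.mul_one g) X
    refine Eq.trans ?_ h₂.symm
    have h₃ : (e g).hom.app ((T' 1).obj X) ≫ (T' g).map ((e 1).inv.app X ≫ a.oneIso.hom.app X) =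
        (T g).map ((e 1).inv.app X ≫ a.oneIso.hom.app X) ≫ (e g).hom.app X :=
      ((e g).hom.naturality ((e 1).inv.app X ≫ a.oneIso.hom.app X)).symm
    have h₄ : (T g).map ((e 1).hom.app X) ≫ (T g).map ((e 1).inv.app X ≫ a.oneIso.hom.app X) =
        (T g).map (a.oneIso.hom.app X) := by
      rw [← Functor.map_comp, Iso.hom_inv_id_app_assoc]
    simp only [Iso.trans_hom, Iso.symm_hom, NatTrans.comp_app, Functor.isoWhiskerRight_hom,
      Functor.isoWhiskerLeft_hom, Functor.whiskerRight_app, Functor.whiskerLeft_app,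
      Category.assoc, Iso.hom_inv_id_app_assoc]
    rw [h₃, reassoc_of% h₄, reassoc_of% h₁]

lemma GroupAction.transport_mulIso {T T' : G → D ⥤ D} (a : GroupAction T) (e : ∀ g, T g ≅ T' g)
    (g h : G) (X : D) : (e (g * h)).hom.app X ≫ ((a.transport e).mulIso g h).hom.app X =
      (a.mulIso g h).hom.app X ≫ (T g).map ((e h).hom.app X) ≫
        (e g).hom.app ((T' h).obj X) := by
  simp [GroupAction.transport]

lemma GroupAction.transport_oneIso {T T' : G → D ⥤ D} (a : GroupAction T) (e : ∀ g, T g ≅ T' g)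
    (X : D) : (e 1).hom.app X ≫ (a.transport e).oneIso.hom.app X = a.oneIso.hom.app X := by
  simp [GroupAction.transport]

/-- The transport of an action by tensor functors along natural isomorphisms. -/
def TensorGroupAction.transport [MonoidalCategory D] {T T' : G → D ⥤ D} (a : TensorGroupAction T)
    (e : ∀ g, T g ≅ T' g) : TensorGroupAction T' :=
  letI (g : G) : (T g).Monoidal := a.monoidal g
  letI (g : G) : (T' g).Monoidal := Functor.Monoidal.transport (e g)
  haveI (g : G) : NatTrans.IsMonoidal (e g).hom :=
    Functor.Monoidal.natTransIsMonoidal_of_transport (e g)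
  haveI (g h : G) : NatTrans.IsMonoidal (a.mulIso g h).hom := a.mulIso_monoidal g h
  haveI : NatTrans.IsMonoidal a.oneIso.hom := a.oneIso_monoidal
  { a.toGroupAction.transport e with
    monoidal := fun g => Functor.Monoidal.transport (e g)
    mulIso_monoidal := fun g h => inferInstanceAs (NatTrans.IsMonoidal
      ((e (g * h)).inv ≫ (a.mulIso g h).hom ≫ Functor.whiskerRight (e h).hom (T g) ≫
        Functor.whiskerLeft (T' h) (e g).hom))
    oneIso_monoidal := inferInstanceAs (NatTrans.IsMonoidal ((e 1).inv ≫ a.oneIso.hom)) }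

lemma TensorGroupAction.isMonoidal_transport [MonoidalCategory D] {T T' : G → D ⥤ D}
    (a : TensorGroupAction T) (e : ∀ g, T g ≅ T' g) (g : G) :
    @NatTrans.IsMonoidal _ _ _ _ _ _ _ _ (e g).hom (a.monoidal g).toLaxMonoidal
      ((a.transport e).monoidal g).toLaxMonoidal :=
  letI (g : G) : (T g).Monoidal := a.monoidal g
  Functor.Monoidal.natTransIsMonoidal_of_transport (e g)

end Transport

/-! ### The transported action with values `g·V` on representatives -/

namespace Intertwiners

section TransportedObject
variable {C : Type u} [Category.{v} C] [MonoidalCategory C]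
  {A : C} [MonObj A] {L : Set (Mod C A)} (D : Intertwiners L)

open Classical in
/-- The isomorphism from `T_g X` to `g • X` if `X` is a representative, and the identity of
`T_g X` otherwise. -/
def transportedIso (g : AutAlg A) (X : Mod C A) : Σ Y : Mod C A, (twist g).obj X ≅ Y :=
  if h : X ∈ L then ⟨(D.rep g ⟨X, h⟩).1, D.iso g ⟨X, h⟩⟩ else ⟨(twist g).obj X, Iso.refl _⟩

/-- The functor isomorphic to `T_g` sending a representative `V` to `g • V`. -/
def transportedTwist (g : AutAlg A) : Mod C A ⥤ Mod C A :=
  (twist g).copyObj (fun X => (D.transportedIso g X).1) (fun X => (D.transportedIso g X).2)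

/-- The comparison between `T_g` and the transported functor. -/
def transportedTwistIso (g : AutAlg A) : twist g ≅ D.transportedTwist g :=
  (twist g).isoCopyObj _ _

lemma transportedTwist_obj (g : AutAlg A) {X : Mod C A} {W : L} (h : X = W.1) :
    (D.transportedTwist g).obj X = (D.rep g W).1 := by
  subst h
  exact congrArg Sigma.fst (dif_pos W.2 : D.transportedIso g W.1 = _)

lemma transportedTwistIso_app_rep (g : AutAlg A) (V : L) :
    (D.transportedTwistIso g).hom.app V.1 ≫
      eqToHom (D.transportedTwist_obj g (X := V.1) rfl) = D.hom g V := by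
  have key {Y : Mod C A} {s t : Σ Z : Mod C A, Y ≅ Z} (e : s = t) (p : s.1 = t.1) :
      s.2.hom ≫ eqToHom p = t.2.hom := by
    subst e
    simp
  exact key (dif_pos V.2 : D.transportedIso g V.1 = _) _

/-- Allowing `X` to be only propositionally a representative covers `X = T'_h V`, which equals `h·V`
through the case distinction in `transportedIso`. -/
lemma transportedTwistIso_app (g : AutAlg A) {X : Mod C A} {W : L} (h : X = W.1) :
    (D.transportedTwistIso g).hom.app X ≫ eqToHom (D.transportedTwist_obj g h) =
      (twist g).map (eqToHom h) ≫ D.hom g W := by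
  subst h
  exact (D.transportedTwistIso_app_rep g W).trans (Category.id_comp (D.hom g W)).symm

end TransportedObject

section Multiplier
variable {C : Type u} [Category.{v} C] [Abelian C] [Linear ℂ C] [MonoidalCategory C]
  [MonoidalPreadditive C] [MonoidalLinear ℂ C] {A : C} [MonObj A] {L : Set (Mod C A)}
  {D : Intertwiners L} {β : L → AutAlg A → AutAlg A → ℂˣ}

lemma IsMultiplier.mulIso_comp (hβ : D.IsMultiplier β) (hL : IsRepresentatives L)
    (g h : AutAlg A) (V : L) :
    (twistMulIso g h).hom.app V.1 ≫ (twist g).map (D.hom h V) ≫ D.hom g (D.rep h V) =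
      (β V g h : ℂ) • (D.hom (g * h) V ≫
        eqToHom (congrArg Subtype.val (D.rep_mul hL g h V))) :=
  Mod.hom_ext _ _ (by
    refine ((Category.id_comp _).trans (hβ g h V)).trans ?_
    refine congrArg ((β V g h : ℂ) • ·) (Eq.symm ?_)
    have e : (eqToHom (congrArg Subtype.val (D.rep_mul hL g h V))).hom = 𝟙 V.1.X :=
      (eqToHom_hom _).trans rfl
    exact (congrArg ((D.u (g * h) V).hom ≫ ·) e).trans (Category.comp_id _))

/-- The transported constraint followed after `e_{gh}` is `e_g ∘ T_g(e_h)`. On representatives the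
comparisons are the `u`, so the constraint becomes `u_g u_h u_{gh}⁻¹ = β_V(g, h)`, up to `eqToHom`.
-/
lemma IsMultiplier.transport_mulIso (hβ : D.IsMultiplier β) (hL : IsRepresentatives L)
    (g h : AutAlg A) (V : L) :
    ∃ p : (D.transportedTwist (g * h)).obj V.1 =
        (D.transportedTwist h ⋙ D.transportedTwist g).obj V.1,
      ((twistAction.transport D.transportedTwistIso).mulIso g h).hom.app V.1 =
        (β V g h : ℂ) • eqToHom p := by
  have p₁ := D.transportedTwist_obj (g * h) (X := V.1) (W := V) rfl
  have p₂ := D.transportedTwist_obj h (X := V.1) (W := V) rfl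
  have p₃ := D.transportedTwist_obj g p₂
  have p : (D.rep (g * h) V).1 = (D.rep g (D.rep h V)).1 :=
    congrArg Subtype.val (D.rep_mul hL g h V)
  refine ⟨p₁.trans (p.trans p₃.symm), ?_⟩
  have e₁ := D.transportedTwistIso_app_rep (g * h) V
  have e₂ := D.transportedTwistIso_app_rep h V
  have e₃ := D.transportedTwistIso_app g p₂
  have e₄ := GroupAction.transport_mulIso twistAction D.transportedTwistIso g h V.1
  have e₅ := hβ.mulIso_comp hL g h V
  rw [← cancel_epi ((D.transportedTwistIso (g * h)).hom.app V.1),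
    ← cancel_mono (eqToHom p₃)]
  refine (congrArg (· ≫ eqToHom p₃) e₄).trans ?_
  rw [Category.assoc, Category.assoc, e₃, ← Functor.map_comp_assoc, e₂]
  refine e₅.trans ?_
  rw [Linear.comp_smul, Linear.smul_comp, ← e₁]
  simp

end Multiplier

end Intertwiners

end AnyonCondensation

end

/-! ### The main theorem -/

open AnyonCondensation in
theorem mainTheorem4
    {C : Type*} [Category C] [Abelian C] [Linear ℂ C] [MonoidalCategory C] [MonoidalPreadditive C]
    [MonoidalLinear ℂ C] [RigidCategory C] [BraidedCategory C] [IsFusion C]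
    (A : C) [MonObj A] [ComonObj A] [IsCommMonObj A] (_hA : IsStronglySeparableFrobenius A) :
    -- systems of representatives exist
    (∃ L : Set (Mod C A), IsRepresentatives L) ∧
    -- the functors `T_g` form a strict tensor action of `Aut(A)` on `Rep A`
    ∃ t : TensorGroupAction (fun g : AutAlg A => twist g),
      (∀ (g h : AutAlg A) (V : Mod C A), ((t.mulIso g h).hom.app V).hom = 𝟙 V.X) ∧
      (∀ V : Mod C A, (t.oneIso.hom.app V).hom = 𝟙 V.X) ∧
      (∀ (g : AutAlg A) (V W : Mod C A),
        tensorMod.π A ((twist g).obj V) ((twist g).obj W) ≫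
          ((t.monoidal g).toLaxMonoidal.μ V W).hom = tensorMod.π A V W) ∧
      (∀ g : AutAlg A, (t.monoidal g).toLaxMonoidal.ε.hom = (g⁻¹).hom.hom) ∧
      ∀ L : Set (Mod C A), IsRepresentatives L →
        -- existence and uniqueness of `ρ'` and, up to a scalar, of `u_g`
        (∀ g : AutAlg A, ∀ V ∈ L, ∃! ρ' : ModObj A V.X, withAct V ρ' ∈ L ∧
          ∃ u : V.X ≅ V.X, Intertwines g V (withAct V ρ') u.hom ∧
            ∀ w : V.X ≅ V.X, Intertwines g V (withAct V ρ') w.hom →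
              ∃ c : ℂˣ, w.hom = (c : ℂ) • u.hom) ∧
        ∀ D : Intertwiners L,
          (∀ V : L, D.rep 1 V = V) ∧
          (∀ (g h : AutAlg A) (V : L), D.rep (g * h) V = D.rep g (D.rep h V)) ∧
          ∃ β : L → AutAlg A → AutAlg A → ℂˣ,
            -- `u_g u_h = β_V(g, h) u_{gh}`
            (∀ (g h : AutAlg A) (V : L), (D.u h V).hom ≫ (D.u g (D.rep h V)).hom =
              (β V g h : ℂ) • (D.u (g * h) V).hom) ∧
            -- `β` is a 2-cocycle
            (∀ (f g h : AutAlg A) (V : L),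
              β (D.rep h V) f g * β V (f * g) h = β V f (g * h) * β V g h) ∧
            -- the `G`-action with composition constraint `β⁻¹`, and its equivariant structures
            (∃ b : GroupAction (fun g : AutAlg A => twist g),
              (∀ (g h : AutAlg A) (V : L), ((b.mulIso g h).hom.app V.1).hom =
                ((β V g h)⁻¹ : ℂ) • 𝟙 V.1.X) ∧
              (∀ V : L, (b.oneIso.hom.app V.1).hom = (D.u 1 V).hom) ∧
              (∀ (g h : AutAlg A) (V : L),
                ((b.mulIso g h).hom.app V.1 ≫ (twist g).map (D.hom h V) ≫
                  D.hom g (D.rep h V)).hom = (D.hom (g * h) V).hom) ∧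
              ∀ (S : Set L) (hS : ∀ (g : AutAlg A), ∀ V ∈ S, D.rep g V ∈ S),
                ∃ (X : EquivariantObject b) (i : ∀ V : S, V.1.1 ⟶ X.obj),
                  Nonempty (IsColimit (Cofan.mk X.obj i)) ∧
                  ∀ (g : AutAlg A) (V : S), (twist g).map (i V) ≫ (X.u g).hom =
                    D.hom g V.1 ≫ i ⟨D.rep g V.1, hS g V.1 V.2⟩) ∧
            -- the tensor action transported along the `u_g`, with composition constraint `β`
            (∃ (T' : AutAlg A → Mod C A ⥤ Mod C A) (s : TensorGroupAction T')
              (e : ∀ g : AutAlg A, twist g ≅ T' g),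
              (∀ g : AutAlg A, @NatTrans.IsMonoidal _ _ _ _ _ _ _ _ (e g).hom
                (t.monoidal g).toLaxMonoidal (s.monoidal g).toLaxMonoidal) ∧
              (∀ (g h : AutAlg A) (X : Mod C A),
                (e (g * h)).hom.app X ≫ (s.mulIso g h).hom.app X =
                  (t.mulIso g h).hom.app X ≫ (twist g).map ((e h).hom.app X) ≫
                    (e g).hom.app ((T' h).obj X)) ∧
              (∀ X : Mod C A, (e 1).hom.app X ≫ s.oneIso.hom.app X = t.oneIso.hom.app X) ∧
              (∀ (g : AutAlg A) (V : L), ∃ p : (T' g).obj V.1 = (D.rep g V).1,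
                (e g).hom.app V.1 ≫ eqToHom p = D.hom g V) ∧
              (∀ (g h : AutAlg A) (V : L), ∃ p : (T' (g * h)).obj V.1 = (T' h ⋙ T' g).obj V.1,
                (s.mulIso g h).hom.app V.1 = (β V g h : ℂ) • eqToHom p)) := by
  refine ⟨exists_isRepresentatives A, twistTensorAction, fun _ _ _ => rfl, fun _ => rfl,
    fun g V W => π_twistTensor g V W, fun _ => rfl, fun L hL => ⟨hL.existsUnique_rho, fun D => ?_⟩⟩
  choose β hβ using D.exists_u_comp_u hL
  replace hβ : D.IsMultiplier (fun V g h => β g h V) := hβ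
  choose c hc using D.exists_u_one hL
  refine ⟨D.rep_one hL, D.rep_mul hL, fun V g h => β g h V, hβ, hβ.cocycle hL, ?_, ?_⟩
  · have h₁ (g h : AutAlg A) (V : L) :
        (((multiplierAction _hA hL hβ hc).mulIso g h).hom.app V.1).hom =
          ((β g h V)⁻¹ : ℂ) • 𝟙 V.1.X :=
      (multiplierAction_mulIso_hom _hA hL hβ hc g h V.1).trans
        ((natScalarHom_apply _hA hL _ V).trans (by rw [Units.val_inv_eq_inv_val]))
    have h₂ (V : L) : ((multiplierAction _hA hL hβ hc).oneIso.hom.app V.1).hom = (D.u 1 V).hom :=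
      (multiplierAction_oneIso_hom _hA hL hβ hc V.1).trans
        ((natScalarHom_apply _hA hL c V).trans (hc V).symm)
    have h₃ (g h : AutAlg A) (V : L) :
        (((multiplierAction _hA hL hβ hc).mulIso g h).hom.app V.1).hom ≫ (D.u h V).hom ≫
          (D.u g (D.rep h V)).hom = (D.u (g * h) V).hom := by
      -- The factor `β⁻¹` of the constraint cancels the `β` produced by `u_g u_h`; this is why the
      -- constraint carries the inverse.
      refine (congrArg (· ≫ _) (h₁ g h V)).trans ?_
      refine (Linear.smul_comp _ _ _ _ _ _).trans ?_
      refine (congrArg (_ • ·) ((Category.id_comp _).trans (hβ g h V))).trans ?_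
      exact inv_smul_smul₀ (β g h V).ne_zero _
    refine ⟨multiplierAction _hA hL hβ hc, h₁, h₂, h₃, fun S hS => ?_⟩
    have : Finite L := hL.finite _hA
    have : Fintype S := Fintype.ofFinite S
    have : HasFiniteBiproducts C := Abelian.hasFiniteBiproducts
    have : HasBiproductsOfShape S C := hasBiproductsOfShape_finite C
    have (g : AutAlg A) : IsIso (sumHom D hS g) := isIso_sumHom D hS _ hL h₃ h₂ g
    exact ⟨⟨sumRep S, fun g => asIso (sumHom D hS g), sumHom_square D hS _ hL h₃⟩,
      biproductMod.incl fun V : S => V.1.1, ⟨biproductMod.isColimit _⟩,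
      map_incl_comp_sumHom D hS⟩
  · exact ⟨D.transportedTwist, twistTensorAction.transport D.transportedTwistIso,
      D.transportedTwistIso, twistTensorAction.isMonoidal_transport D.transportedTwistIso,
      twistAction.transport_mulIso D.transportedTwistIso,
      twistAction.transport_oneIso D.transportedTwistIso,
      fun g V => ⟨D.transportedTwist_obj g rfl, D.transportedTwistIso_app_rep g V⟩,
      hβ.transport_mulIso hL⟩
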